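/- Let $\mathbb{G}$ be a Carnot group, i.e. a simply connected Lie group whose Lie algebra has a stratification $\mathfrak{g}=V_1\oplus\cdots\oplus V_s$ with $V_{i}=[V_1,V_{i-1}]$ for $2\le i\le s$ and $[V_1,V_s]=0$. Identify $\mathbb{G}$ with $\mathfrak{g}$ by exponential coordinates of the first kind, so that the group law is given by the Baker--Campbell--Hausdorff formula and the identity is $0$. Let $\delta_r$ ($r>0$) be the dilations, which multiply $V_i$ by $r^i$. Fix a basis $X_1,\dots,X_k$ of $V_1$, let $\omega$ be the inner product norm on $V_1$ for which it is orthonormal, and let $d$ be the Carnot--Carath\'eodory distance: $d(x,y)$ is the infimum of $\int_a^b|u|$ over the absolutely continuous curves $\gamma\colon[a,b]\to\mathbb{G}$ joining $x$ to $y$ with $\gamma'=\sum_j u_jX_j(\gamma)$ almost everywhere, $u_j\in L^1[a,b]$ (the $X_j$ being regarded as left invariant vector fields). Write $d(x)=d(x,0)$. A function $L\colon\mathbb{G}\to\mathbb{R}$ is $\mathbb{G}$-linear if $L(xy)=L(x)+L(y)$ and $L(\delta_r(x))=rL(x)$ for all $x,y\in\mathbb{G}$, $r>0$. A function $f\colon\mathbb{G}\to\mathbb{R}$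 is Pansu differentiable at $x$ with Pansu differential $L$ if $L$ is $\mathbb{G}$-linear and \[\lim_{y\to x}\frac{|f(y)-f(x)-L(x^{-1}y)|}{d(x,y)}=0.\] Suppose that $d$ is differentiable in horizontal directions, i.e. that the function $y\mapsto d(y)$ is Pansu differentiable at $\exp(E)$ for every $E\in V_1\setminus\{0\}$. Let $f\colon\mathbb{G}\to\mathbb{R}$ be Lipschitz with respect to $d$, with best Lipschitz constant $\mathrm{Lip}_{\mathbb{G}}(f)$, let $x\in\mathbb{G}$ and let $E\in V_1$ with $\omega(E)=1$. Suppose that the directional derivative \[Ef(x)=\lim_{t\to0}\frac{f(x\exp(tE))-f(x)}{t}\] exists and that $Ef(x)=\mathrm{Lip}_{\mathbb{G}}(f)$. Then $f$ is Pansu differentiable at $x$, with Pansu differential $w\mapsto\mathrm{Lip}_{\mathbb{G}}(f)\,L(w)$, where $L$ is the Pansu differential of the function $d$ at $\exp(E)$. -/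

import Mathlib

open Filter Topology MeasureTheory

/-- A Carnot group in exponential coordinates of the first kind. The data are a real Lie algebra
structure (`bracket`) on the vector space `𝔤` and a stratification
`𝔤 = V₁ ⊕ ⋯ ⊕ Vₛ` with `V_{i+1} = [V₁, V_i]` and `[V₁, Vₛ] = 0`; here `V_i = layer i`, with the
convention `V_0 = 0` and `V_i = 0` for `i > s`. The simply connected Lie group with this Lie algebra
is `𝔤` itself, with the Baker-Campbell-Hausdorff product `CarnotGroup.mul` defined below; it has
identity `0` and inverse `x ↦ -x`. (The norm on `𝔤` only serves to provide the usual topology and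
calculus of a finite-dimensional real vector space.) -/
structure CarnotGroup (𝔤 : Type*) [NormedAddCommGroup 𝔤] [NormedSpace ℝ 𝔤] where
  bracket : 𝔤 →ₗ[ℝ] 𝔤 →ₗ[ℝ] 𝔤
  bracket_self : ∀ x, bracket x x = 0
  jacobi : ∀ x y z,
    bracket x (bracket y z) + bracket z (bracket x y) + bracket y (bracket z x) = 0
  step : ℕ
  layer : ℕ → Submodule ℝ 𝔤
  layer_zero : layer 0 = ⊥
  layer_succ : ∀ i, 1 ≤ i → layer (i + 1) = Submodule.map₂ bracket (layer 1) (layer i)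
  layer_eq_bot : ∀ i, step < i → layer i = ⊥
  isInternal : DirectSum.IsInternal layer

noncomputable section

namespace CarnotGroup

variable {𝔤 : Type*} [NormedAddCommGroup 𝔤] [NormedSpace ℝ 𝔤] (G : CarnotGroup 𝔤)

/-! ### Group structure and dilations -/

/-- The adjoint endomorphism `ad x = [x, ·]`. It is nilpotent: `(ad x)^s = 0`. -/
def ad (x : 𝔤) : Module.End ℝ 𝔤 := G.bracket x

/-- `e^{ad x}`; the exponential series is finite, because `ad x` is nilpotent. -/
def expAd (x : 𝔤) : Module.End ℝ 𝔤 :=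
  ∑ k ∈ Finset.range (G.step + 1), ((k.factorial : ℝ)⁻¹) • (G.ad x) ^ k

/-- The power series at `A = 1` of `ψ(A) = A log A / (A - 1)`, namely
`ψ(A) = 1 - ∑_{n ≥ 1} (1 - A)^n / (n (n + 1))`. It is applied only to operators `A` for which
`1 - A` maps `V_i` into `V_{i+1} ⊕ ⋯ ⊕ V_s`, and for these the terms with `n > s` vanish. -/
def psi (A : Module.End ℝ 𝔤) : Module.End ℝ 𝔤 :=
  1 - ∑ n ∈ Finset.Icc 1 G.step, ((n : ℝ) * ((n : ℝ) + 1))⁻¹ • (1 - A) ^ n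

/-- The group product, given by the Baker-Campbell-Hausdorff formula in its integral form
`x · y = log (e^x e^y) = x + ∫₀¹ ψ(e^{ad x} e^{t ad y}) y dt`
(so `x · y = x + y + [x, y] / 2 + [x, [x, y]] / 12 + [y, [y, x]] / 12 + ⋯`). -/
def mul (x y : 𝔤) : 𝔤 :=
  x + ∫ t in (0 : ℝ)..1, G.psi (G.expAd x * G.expAd (t • y)) y

/-- The group inverse. -/
def inv (_G : CarnotGroup 𝔤) (x : 𝔤) : 𝔤 := -x

/-- The exponential map of the group is the identity in exponential coordinates of the first
kind. -/
def exp (_G : CarnotGroup 𝔤) (X : 𝔤) : 𝔤 := X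

/-- The projection of `𝔤 = V₁ ⊕ ⋯ ⊕ Vₛ` onto `V_i`. -/
def component (i : ℕ) : 𝔤 →ₗ[ℝ] 𝔤 :=
  (G.layer i).subtype ∘ₗ DirectSum.component ℝ ℕ (fun j => G.layer j) i ∘ₗ
    (LinearEquiv.ofBijective (DirectSum.coeLinearMap G.layer) G.isInternal).symm.toLinearMap

/-- The dilation `δ_r`, which multiplies `V_i` by `r ^ i`. -/
def dilation (r : ℝ) (x : 𝔤) : 𝔤 :=
  ∑ i ∈ Finset.range (G.step + 1), r ^ i • G.component i x

/-! ### Horizontal curves and the Carnot-Carathéodory distance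

The inner product on the horizontal layer `V₁` is the one for which the given basis `X` of `V₁` is
orthonormal. -/

/-- The left invariant vector field on the group determined by `E`: its value at `p` is the velocity
at `t = 0` of the curve `t ↦ p · exp (t E)`. -/
def leftInvariantField (E p : 𝔤) : 𝔤 :=
  deriv (fun t : ℝ => G.mul p (G.exp (t • E))) 0

variable {r : ℕ} (X : Module.Basis (Fin r) ℝ (G.layer 1))

/-- The inner product norm `ω` on `V₁` for which `X` is an orthonormal basis. -/
def omega (E : G.layer 1) : ℝ := Real.sqrt (∑ j, (X.repr E j) ^ 2)

/-- `γ` is a horizontal curve on `[a, b]` with controls `u_j ∈ L¹[a, b]`: it is absolutely continuous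
and `γ' = ∑ u_j X_j(γ)` almost everywhere on `[a, b]`. -/
structure IsHorizontal (a b : ℝ) (γ : ℝ → 𝔤) (u : Fin r → ℝ → ℝ) : Prop where
  absolutelyContinuous : AbsolutelyContinuousOnInterval γ a b
  integrable : ∀ j, IntervalIntegrable (u j) volume a b
  hasDerivAt : ∀ᵐ t ∂(volume.restrict (Set.Icc a b)),
    HasDerivAt γ (∑ j, u j t • G.leftInvariantField (X j : 𝔤) (γ t)) t

/-- The length `∫_a^b |u|` of the horizontal curve with controls `u`. -/
def controlLength (a b : ℝ) (u : Fin r → ℝ → ℝ) : ℝ :=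
  ∫ t in a..b, Real.sqrt (∑ j, (u j t) ^ 2)

/-- The Carnot-Carathéodory distance: the infimum of the lengths of the horizontal curves that
join `x` to `y`. -/
def ccDist (x y : 𝔤) : ℝ :=
  sInf {l : ℝ | ∃ (a b : ℝ) (γ : ℝ → 𝔤) (u : Fin r → ℝ → ℝ), a ≤ b ∧ G.IsHorizontal X a b γ u ∧
    γ a = x ∧ γ b = y ∧ l = controlLength a b u}

/-- The function `d(x) = d(x, 0)`. -/
def ccNorm (x : 𝔤) : ℝ := G.ccDist X x 0

/-! ### Lipschitz functions, directional derivatives, Pansu differentiability -/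

/-- `f` is `K`-Lipschitz with respect to the Carnot-Carathéodory distance. -/
def IsLipschitzWith (K : ℝ) (f : 𝔤 → ℝ) : Prop :=
  0 ≤ K ∧ ∀ x y, |f x - f y| ≤ K * G.ccDist X x y

/-- `f` is Lipschitz with respect to the Carnot-Carathéodory distance. -/
def IsLipschitz (f : 𝔤 → ℝ) : Prop := ∃ K, G.IsLipschitzWith X K f

/-- The best Lipschitz constant of `f` with respect to the Carnot-Carathéodory distance. -/
def lip (f : 𝔤 → ℝ) : ℝ := sInf {K | G.IsLipschitzWith X K f}

/-- The directional derivative `Ef(x) = lim_{t → 0} (f (x exp (tE)) - f x) / t` exists and is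
equal to `c`. -/
def HasDirDeriv (f : 𝔤 → ℝ) (E x : 𝔤) (c : ℝ) : Prop :=
  Tendsto (fun t : ℝ => (f (G.mul x (G.exp (t • E))) - f x) / t) (𝓝[≠] 0) (𝓝 c)

/-- `L` is `𝔾`-linear. -/
def IsGLinear (L : 𝔤 → ℝ) : Prop :=
  (∀ x y, L (G.mul x y) = L x + L y) ∧ ∀ r : ℝ, 0 < r → ∀ x, L (G.dilation r x) = r * L x

/-- `f` is Pansu differentiable at `x` with Pansu differential `L`: `L` is `𝔾`-linear and
`|f y - f x - L (x⁻¹ y)| / d(x, y) → 0` as `y → x`, a limit in the metric space `(𝔾, d)`. -/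
def HasPansuDifferential (f : 𝔤 → ℝ) (x : 𝔤) (L : 𝔤 → ℝ) : Prop :=
  G.IsGLinear L ∧ ∀ ε : ℝ, 0 < ε → ∃ δ : ℝ, 0 < δ ∧ ∀ y, y ≠ x → G.ccDist X x y < δ →
    |f y - f x - L (G.mul (G.inv x) y)| / G.ccDist X x y < ε

/-- `f` is Pansu differentiable at `x`. -/
def PansuDifferentiableAt (f : 𝔤 → ℝ) (x : 𝔤) : Prop :=
  ∃ L : 𝔤 → ℝ, G.HasPansuDifferential X f x L

/-- The Carnot-Carathéodory distance is differentiable in horizontal directions: `y ↦ d(y, 0)` is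
Pansu differentiable at `exp E` for every `E ∈ V₁ \ {0}`. -/
def DistDifferentiableInHorizontalDirections : Prop :=
  ∀ E : G.layer 1, E ≠ 0 → G.PansuDifferentiableAt X (G.ccNorm X) (G.exp (E : 𝔤))

end CarnotGroup

end

/-! Write K for the best Lipschitz constant and ⟨E, ·⟩ for the inner product of E with the
horizontal part. For small w let s be a large fixed multiple of d(w). Moving from x exp(-sE) to xw
gives f(xw) ≤ f(x exp(-sE)) + K d(w, exp(-sE)). The directional derivative makes the first term f(x)
- sK + o(s). Left translation and dilation turn the distance into s d(exp(E) δ_{1/s} w), about s +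
L(w). The terms sK cancel, leaving f(xw) ≤ f(x) + K L(w) + small. Comparison with x exp(sE) gives
the lower bound f(x) - K L'(w), with L' the differential of d at exp(-E). This is
`hasPansuDifferential_of_dirDeriv_eq_lip`.

The two bounds match because L' = -L. Indeed ⟨E, ·⟩ ≤ d on points joined to 0, with equality at
exp(E) (`pairing_le_ccNorm`, `ccNorm_of_omega_eq_one`). So L - ⟨E, ·⟩ is nonnegative and odd, hence
zero, wherever d is positive; the same holds for -E.

Most of the work is to show that the integral Baker-Campbell-Hausdorff formula defines a smooth
group law for which d is left invariant and homogeneous. An ODE argument (`exp_adL_bchCurve`,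
`exp_representation_mul`) shows that it becomes the product of exponentials in every representation
of the Lie algebra. The faithful nilpotent representation `extAd` then transfers the group laws and
smoothness from operators. -/

noncomputable section BanachAlgebraExponential

/-! ### Exponential, logarithm and ψ of nilpotent elements of a Banach algebra -/

namespace NormedSpace

variable {A : Type*} [NormedRing A] [NormedAlgebra ℝ A]

theorem exp_eq_sum_of_pow_eq_zero {N : A} {m : ℕ} (hN : N ^ (m + 1) = 0) :
    exp N = ∑ k ∈ Finset.range (m + 1), ((k.factorial : ℝ)⁻¹) • N ^ k := by
  rw [exp_eq_tsum ℝ]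
  refine tsum_eq_sum fun k hk => ?_
  rw [pow_eq_zero_of_le (by simpa using hk) hN, smul_zero]

theorem smul_pow_eq_zero {N : A} {m : ℕ} (hN : N ^ m = 0) (c : ℝ) : (c • N) ^ m = 0 := by
  rw [smul_pow, hN, smul_zero]

theorem commute_exp_smul (N : A) (τ : ℝ) : Commute N (exp (τ • N)) := by
  let := NormedAlgebra.restrictScalars ℚ ℝ A
  exact ((Commute.refl N).smul_right τ).exp_right

/-- What matters is that M commutes with N, so that 1 - e^N inherits the nilpotency of N. -/
theorem exists_exp_sub_one_eq_mul {N : A} {m : ℕ} (hN : N ^ (m + 1) = 0) :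
    ∃ M, Commute N M ∧ 1 - exp N = N * M := by
  refine ⟨-∑ k ∈ Finset.range m, (((k + 1).factorial : ℝ)⁻¹) • N ^ k, ?_, ?_⟩
  · exact (Commute.sum_right _ _ _ fun k _ => ((Commute.refl N).pow_right k).smul_right _).neg_right
  · rw [exp_eq_sum_of_pow_eq_zero hN, Finset.sum_range_succ', mul_neg, Finset.mul_sum]
    simp [pow_succ']

theorem one_sub_exp_pow_eq_zero {N : A} {m : ℕ} (hN : N ^ (m + 1) = 0) :
    (1 - exp N) ^ (m + 1) = 0 := by
  obtain ⟨M, hM, h⟩ := exists_exp_sub_one_eq_mul hN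
  rw [h, hM.mul_pow, hN, zero_mul]

theorem _root_.HasDerivAt.pow_of_commute {u : ℝ → A} {u' : A} {t : ℝ} (hu : HasDerivAt u u' t)
    (hc : Commute (u t) u') (n : ℕ) :
    HasDerivAt (fun t => u t ^ (n + 1)) (((n : ℝ) + 1) • (u t ^ n * u')) t := by
  induction n with
  | zero => simpa using hu
  | succ n ih =>
    have h := ih.fun_mul hu
    simp only [← pow_succ] at h
    refine h.congr_deriv ?_
    have : u' * u t = u t * u' := hc.eq.symm
    push_cast
    rw [smul_mul_assoc, mul_assoc, this, ← mul_assoc, ← pow_succ,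
      add_smul ((n : ℝ) + 1) (1 : ℝ), one_smul]

/-- Partial fractions 1/((n+1)(n+2)) = 1/(n+1) - 1/(n+2) turn ψ(1-u) into (1-u) times the series of
-log(1-u)/u. The remainder vanishes once u^(m+1) = 0. -/
theorem sum_shifted_telescope (u : A) (m : ℕ) :
    1 - ∑ n ∈ Finset.range m, (((n : ℝ) + 1) * ((n : ℝ) + 2))⁻¹ • u ^ (n + 1) =
      (1 - u) * ∑ n ∈ Finset.range (m + 1), ((n : ℝ) + 1)⁻¹ • u ^ n
        + ((m : ℝ) + 1)⁻¹ • u ^ (m + 1) := by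
  induction m with
  | zero => simp
  | succ m ih =>
    rw [Finset.sum_range_succ, ← sub_sub, ih, Finset.sum_range_succ _ (m + 1),
      mul_add (1 - u), mul_smul_comm,
      sub_mul 1 u (u ^ (m + 1)), one_mul, ← pow_succ', smul_sub, add_sub_assoc, ← sub_smul, add_assoc]
    congr 1
    push_cast
    rw [show ((m : ℝ) + 1)⁻¹ - (((m : ℝ) + 1) * (m + 2))⁻¹ = ((m : ℝ) + 1 + 1)⁻¹ by
      field_simp; ring]
    abel

variable [CompleteSpace A]

theorem exp_neg_mul_exp_self (x : A) : exp (-x) * exp x = 1 := by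
  let := NormedAlgebra.restrictScalars ℚ ℝ A
  rw [← exp_add_of_commute (Commute.refl x).neg_left, neg_add_cancel, exp_zero]

theorem continuous_exp_real : Continuous (exp : A → A) := by
  let := NormedAlgebra.restrictScalars ℚ ℝ A
  exact exp_continuous

theorem exp_add_smul (x : A) (s t : ℝ) : exp ((s + t) • x) = exp (s • x) * exp (t • x) := by
  let := NormedAlgebra.restrictScalars ℚ ℝ A
  rw [add_smul, exp_add_of_commute]
  exact ((Commute.refl x).smul_left s).smul_right t

theorem contDiff_exp_real : ContDiff ℝ ⊤ (exp : A → A) :=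
  contDiff_iff_contDiffAt.2 fun x => (exp_analytic (𝕂 := ℝ) x).contDiffAt

theorem hasDerivAt_exp_one_sub_smul (x : A) (s : ℝ) :
    HasDerivAt (fun s : ℝ => exp ((1 - s) • x)) (-(exp ((1 - s) • x) * x)) s := by
  have h := (hasDerivAt_exp_smul_const (𝕂 := ℝ) x (1 - s)).scomp s
    ((hasDerivAt_id s).const_sub 1)
  simpa [Function.comp_def] using h

/-- Duhamel's formula. -/
theorem exp_sub_exp_eq_integral (x y : A) :
    exp y - exp x = ∫ s in (0 : ℝ)..1, exp ((1 - s) • x) * (y - x) * exp (s • y) := by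
  have hc := continuous_exp_real (A := A)
  have h : ∀ s ∈ Set.uIcc (0 : ℝ) 1, HasDerivAt (fun s : ℝ => exp ((1 - s) • x) * exp (s • y))
      (exp ((1 - s) • x) * (y - x) * exp (s • y)) s := fun s _ => by
    refine ((hasDerivAt_exp_one_sub_smul x s).mul
      (hasDerivAt_exp_smul_const' (𝕂 := ℝ) y s)).congr_deriv ?_
    noncomm_ring
  rw [intervalIntegral.integral_eq_sub_of_hasDerivAt h]
  · simp [exp_zero]
  · exact Continuous.intervalIntegrable (by fun_prop) _ _

/-- Duhamel's formula between x and x + th carries a factor t; divide by it and let t → 0 under the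
integral. -/
theorem fderiv_exp_eq_integral (x h : A) :
    fderiv ℝ exp x h = ∫ s in (0 : ℝ)..1, exp ((1 - s) • x) * h * exp (s • x) := by
  have hc := continuous_exp_real (A := A)
  have hd : HasDerivAt (fun t : ℝ => exp (x + t • h)) (fderiv ℝ exp x h) 0 := by
    have h1 : HasFDerivAt (exp : A → A) (fderiv ℝ exp x) (x + (0 : ℝ) • h) := by
      simpa using ((contDiff_exp_real (A := A)).differentiable (by simp) x).hasFDerivAt
    have h2 : HasDerivAt (fun t : ℝ => x + t • h) h 0 := by
      simpa using ((hasDerivAt_id (0 : ℝ)).smul_const h).const_add x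
    exact h1.comp_hasDerivAt 0 h2
  have hcont : Continuous fun t : ℝ =>
      ∫ s in (0 : ℝ)..1, exp ((1 - s) • x) * h * exp (s • (x + t • h)) :=
    intervalIntegral.continuous_parametric_intervalIntegral_of_continuous' (by fun_prop) _ _
  have hlim := (hcont.tendsto 0).mono_left (nhdsWithin_le_nhds (s := {0}ᶜ))
  simp only [zero_smul, add_zero] at hlim
  refine tendsto_nhds_unique (hasDerivAt_iff_tendsto_slope.1 hd) (hlim.congr' ?_)
  filter_upwards [self_mem_nhdsWithin] with t ht
  have ht : t ≠ 0 := ht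
  rw [slope_def_module, sub_zero, zero_smul, add_zero, exp_sub_exp_eq_integral,
    ← intervalIntegral.integral_smul]
  refine intervalIntegral.integral_congr fun s _ => ?_
  simp [smul_smul, ht]

theorem hasDerivAt_exp_comp {Z : ℝ → A} {Z' : A} {t : ℝ} (hZ : HasDerivAt Z Z' t) :
    HasDerivAt (fun t => exp (Z t))
      (∫ s in (0 : ℝ)..1, exp ((1 - s) • Z t) * Z' * exp (s • Z t)) t := by
  rw [← fderiv_exp_eq_integral]
  exact ((contDiff_exp_real (A := A)).differentiable (by simp) _).hasFDerivAt.comp_hasDerivAt t hZ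

theorem hasDerivAt_one_sub_exp_smul_pow (N : A) (τ : ℝ) (n : ℕ) :
    HasDerivAt (fun τ : ℝ => (1 - exp (τ • N)) ^ (n + 1))
      (-(((n : ℝ) + 1) • ((1 - exp (τ • N)) ^ n * (exp (τ • N) * N)))) τ := by
  have h : HasDerivAt (fun τ : ℝ => 1 - exp (τ • N)) (-(exp (τ • N) * N)) τ :=
    (hasDerivAt_exp_smul_const (𝕂 := ℝ) N τ).const_sub 1
  have hc := commute_exp_smul N τ
  have := h.pow_of_commute (((Commute.one_left _).sub_left
    ((Commute.refl _).mul_right hc.symm)).neg_right) n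
  simpa [mul_neg, smul_neg] using this

/-- The logarithm series inverts the exponential of a nilpotent element. -/
theorem sum_one_sub_exp_pow {N : A} {m : ℕ} (hN : N ^ (m + 1) = 0) :
    ∑ n ∈ Finset.range (m + 1), ((n : ℝ) + 1)⁻¹ • (1 - exp N) ^ (n + 1) = -N := by
  -- With u = 1 - e^{τN}, differentiating the series leaves a geometric sum, whose product with
  -- e^{τN} = 1 - u is 1 - u^(m+1) = 1.
  have hd : ∀ τ : ℝ, HasDerivAt
      (fun τ : ℝ => ∑ n ∈ Finset.range (m + 1), ((n : ℝ) + 1)⁻¹ • (1 - exp (τ • N)) ^ (n + 1) + τ • N)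
      0 τ := fun τ => by
    have h1 := (HasDerivAt.fun_sum (u := Finset.range (m + 1)) fun n _ =>
      (hasDerivAt_one_sub_exp_smul_pow N τ n).const_smul ((n : ℝ) + 1)⁻¹).add
        ((hasDerivAt_id τ).smul_const N)
    refine h1.congr_deriv ?_
    have h2 : ∀ n ∈ Finset.range (m + 1), ((n : ℝ) + 1)⁻¹ •
        (-(((n : ℝ) + 1) • ((1 - exp (τ • N)) ^ n * (exp (τ • N) * N)))) =
        (1 - exp (τ • N)) ^ n * (-(exp (τ • N) * N)) := fun n _ => by
      rw [smul_neg, smul_smul, inv_mul_cancel₀ (by positivity), one_smul, mul_neg]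
    rw [Finset.sum_congr rfl h2, ← Finset.sum_mul]
    have h3 := geom_sum_mul_neg (1 - exp (τ • N)) (m + 1)
    rw [one_sub_exp_pow_eq_zero (smul_pow_eq_zero hN τ), sub_sub_cancel, sub_zero] at h3
    rw [mul_neg, ← mul_assoc, h3]
    simp
  have := is_const_of_deriv_eq_zero (fun τ => (hd τ).differentiableAt) (fun τ => (hd τ).deriv) 1 0
  simp only [one_smul, zero_smul, exp_zero, sub_self, add_zero] at this
  rw [← eq_neg_iff_add_eq_zero.2 (this.trans ?_)]
  simp

/-- For nilpotent `N`, the power series `ψ(A) = A log A / (A - 1)` at `A = e^N` is the inverse of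
`(1 - e^{-N}) / N = ∫₀¹ e^{-sN} ds`. -/
theorem integral_exp_mul_psi {N : A} {m : ℕ} (hN : N ^ (m + 1) = 0) :
    (∫ s in (0 : ℝ)..1, exp (-(s • N))) *
      (1 - ∑ n ∈ Finset.range m, (((n : ℝ) + 1) * ((n : ℝ) + 2))⁻¹ • (1 - exp N) ^ (n + 1)) = 1 := by
  have hcont := continuous_exp_real (A := A)
  -- The claim is the case τ = 1 of K(τ) P(τ) = τ, proved by showing that the left side has
  -- derivative 1.
  set K : ℝ → A := fun τ => ∫ s in (0 : ℝ)..τ, exp (-(s • N)) with hK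
  set u : ℝ → A := fun τ => 1 - exp (τ • N) with hu
  set P : ℝ → A := fun τ => 1 - ∑ n ∈ Finset.range m,
    (((n : ℝ) + 1) * ((n : ℝ) + 2))⁻¹ • u τ ^ (n + 1) with hP
  have hKd : ∀ τ, HasDerivAt K (exp (-(τ • N))) τ := fun τ =>
    (show Continuous fun s : ℝ => exp (-(s • N)) by fun_prop).integral_hasStrictDerivAt 0 τ
      |>.hasDerivAt
  have hPd : ∀ τ, HasDerivAt P
      ((∑ n ∈ Finset.range m, ((n : ℝ) + 2)⁻¹ • u τ ^ n) * (N * exp (τ • N))) τ := fun τ => by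
    refine ((HasDerivAt.fun_sum (u := Finset.range m) fun n _ =>
      (hasDerivAt_one_sub_exp_smul_pow N τ n).const_smul
        (((n : ℝ) + 1) * ((n : ℝ) + 2))⁻¹).const_sub 1).congr_deriv ?_
    rw [Finset.sum_mul, ← Finset.sum_neg_distrib]
    refine Finset.sum_congr rfl fun n _ => ?_
    rw [smul_neg, neg_neg, smul_smul, smul_mul_assoc, (commute_exp_smul N τ).eq]
    congr 1
    field_simp
  have hKN : ∀ τ, K τ * N = 1 - exp (-(τ • N)) := fun τ => by
    have h : ∀ s ∈ Set.uIcc (0 : ℝ) τ,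
        HasDerivAt (fun s : ℝ => -exp (-(s • N))) (exp (-(s • N)) * N) s := fun s _ => by
      have := (hasDerivAt_exp_smul_const (𝕂 := ℝ) (-N) s).fun_neg
      simpa [smul_neg] using this
    have h2 := intervalIntegral.integral_eq_sub_of_hasDerivAt h
      (Continuous.intervalIntegrable (by fun_prop) _ _)
    rw [show K τ * N = ∫ s in (0 : ℝ)..τ, exp (-(s • N)) * N from ?_, h2]
    · simp [exp_zero]; abel
    · have := ((ContinuousLinearMap.mul ℝ A).flip N).intervalIntegral_comp_comm
        (Continuous.intervalIntegrable (μ := volume)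
          (show Continuous fun s : ℝ => exp (-(s • N)) by fun_prop) 0 τ)
      simpa using this.symm
  have hd : ∀ τ, HasDerivAt (fun τ => K τ * P τ) 1 τ := fun τ => by
    refine ((hKd τ).mul (hPd τ)).congr_deriv ?_
    have hcu : Commute (u τ) (N * exp (τ • N)) := by
      have := commute_exp_smul N τ
      exact (Commute.one_left _).sub_left (this.symm.mul_right (Commute.refl _))
    have hcs : Commute (∑ n ∈ Finset.range m, ((n : ℝ) + 2)⁻¹ • u τ ^ n) (N * exp (τ • N)) :=
      Commute.sum_left _ _ _ fun n _ => (hcu.pow_left n).smul_left _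
    rw [hcs.eq, ← mul_assoc (K τ), ← mul_assoc (K τ), hKN, sub_mul 1, one_mul,
      exp_neg_mul_exp_self, ← neg_sub, show 1 - exp (τ • N) = u τ from rfl]
    -- By the telescoped form, e^{-τN} P = ∑_{n ≤ m} uⁿ/(n+1); the other term of the derivative
    -- removes everything but n = 0.
    rw [hP]
    simp only
    rw [sum_shifted_telescope, one_sub_exp_pow_eq_zero (smul_pow_eq_zero hN τ), smul_zero, add_zero,
      ← mul_assoc, show (1 - u τ) = exp (τ • N) by simp [hu], exp_neg_mul_exp_self, one_mul,
      Finset.sum_range_succ']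
    rw [neg_mul, Finset.mul_sum]
    have : ∀ n ∈ Finset.range m, u τ * ((n : ℝ) + 2)⁻¹ • u τ ^ n =
        (((n + 1 : ℕ) : ℝ) + 1)⁻¹ • u τ ^ (n + 1) := fun n _ => by
      rw [mul_smul_comm, ← pow_succ']; push_cast; congr 2; ring
    rw [Finset.sum_congr rfl this]
    simp
  have hd' : ∀ τ, HasDerivAt (fun τ : ℝ => K τ * P τ - τ • (1 : A)) 0 τ := fun τ => by
    simpa using (hd τ).fun_sub ((hasDerivAt_id τ).smul_const (1 : A))
  have := is_const_of_deriv_eq_zero (fun τ => (hd' τ).differentiableAt) (fun τ => (hd' τ).deriv) 1 0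
  simp only [hK, hP, hu, one_smul, zero_smul, intervalIntegral.integral_same, zero_mul,
    sub_self] at this
  exact sub_eq_zero.1 this

end NormedSpace

end BanachAlgebraExponential

noncomputable section

namespace CarnotGroup

variable {𝔤 : Type*} [NormedAddCommGroup 𝔤] [NormedSpace ℝ 𝔤] (G : CarnotGroup 𝔤)

/-! ### The grading -/

theorem iSup_layer : ⨆ i, G.layer i = ⊤ := G.isInternal.submodule_iSup_eq_top

/-- Linear maps that agree on every layer are equal. -/
theorem linearMap_ext {W : Type*} [AddCommGroup W] [Module ℝ W] {S T : 𝔤 →ₗ[ℝ] W}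
    (h : ∀ i, ∀ x ∈ G.layer i, S x = T x) : S = T := by
  have : ⨆ i, G.layer i ≤ LinearMap.eqLocus S T := iSup_le fun i x hx => h i x hx
  ext x
  exact this (by rw [iSup_layer]; trivial)

theorem bracket_neg_swap (x y : 𝔤) : G.bracket x y = -G.bracket y x := by
  have h := G.bracket_self (x + y)
  simp only [map_add, LinearMap.add_apply, G.bracket_self, zero_add, add_zero] at h
  exact eq_neg_of_add_eq_zero_right h

theorem bracket_bracket (x y z : 𝔤) :
    G.bracket (G.bracket x y) z =
      G.bracket x (G.bracket y z) - G.bracket y (G.bracket x z) := by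
  have h := G.jacobi x y z
  rw [G.bracket_neg_swap z (G.bracket x y), G.bracket_neg_swap z x, map_neg] at h
  rw [← sub_eq_zero, ← neg_eq_zero, ← h]
  abel

theorem eq_zero_of_mem_layer_zero {x : 𝔤} (hx : x ∈ G.layer 0) : x = 0 := by
  rwa [G.layer_zero, Submodule.mem_bot] at hx

theorem bracket_mem_layer_of_mem_one {a : 𝔤} (ha : a ∈ G.layer 1) {j : ℕ} {y : 𝔤}
    (hy : y ∈ G.layer j) : G.bracket a y ∈ G.layer (j + 1) := by
  rcases Nat.eq_zero_or_pos j with rfl | hj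
  · rw [G.eq_zero_of_mem_layer_zero hy, map_zero]; exact zero_mem _
  · rw [G.layer_succ j hj]; exact Submodule.apply_mem_map₂ _ ha hy

/-- The stratification only controls brackets with V₁. Elements of V_{i+1} are sums of brackets [a,
b] with a in V₁, and the Jacobi identity reduces [[a, b], y] to brackets with a and b. -/
theorem bracket_mem_layer (i : ℕ) : ∀ {j : ℕ} {x y : 𝔤}, x ∈ G.layer i → y ∈ G.layer j →
    G.bracket x y ∈ G.layer (i + j) := by
  induction i with
  | zero =>
    intro j x y hx _
    rw [G.eq_zero_of_mem_layer_zero hx, map_zero]; exact zero_mem _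
  | succ i ih =>
    intro j x y hx hy
    rcases Nat.eq_zero_or_pos i with rfl | hi
    · rw [add_comm]; exact G.bracket_mem_layer_of_mem_one hx hy
    · rw [G.layer_succ i hi] at hx
      have : Submodule.map₂ G.bracket (G.layer 1) (G.layer i) ≤
          (G.layer (i + 1 + j)).comap (G.bracket.flip y) := by
        refine Submodule.map₂_le.2 fun a ha b hb => ?_
        rw [Submodule.mem_comap, LinearMap.flip_apply, G.bracket_bracket]
        refine sub_mem ?_ ?_
        · have := G.bracket_mem_layer_of_mem_one ha (ih hb hy)
          rwa [show i + j + 1 = i + 1 + j by ring] at this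
        · have := ih hb (G.bracket_mem_layer_of_mem_one ha hy)
          rwa [show i + (j + 1) = i + 1 + j by ring] at this
      exact this hx

theorem component_mem (i : ℕ) (x : 𝔤) : G.component i x ∈ G.layer i := by
  simp [component]

theorem decompose_of_mem {i : ℕ} {x : 𝔤} (hx : x ∈ G.layer i) :
    (LinearEquiv.ofBijective (DirectSum.coeLinearMap G.layer) G.isInternal).symm x =
      DirectSum.lof ℝ ℕ (fun j => G.layer j) i ⟨x, hx⟩ := by
  rw [LinearEquiv.symm_apply_eq]
  exact (DirectSum.coeLinearMap_lof G.layer i ⟨x, hx⟩).symm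

theorem component_of_mem {i : ℕ} {x : 𝔤} (hx : x ∈ G.layer i) : G.component i x = x := by
  simp [component, G.decompose_of_mem hx, DirectSum.component.lof_self]

theorem component_of_mem_ne {i j : ℕ} {x : 𝔤} (hx : x ∈ G.layer i) (hij : i ≠ j) :
    G.component j x = 0 := by
  have h := DirectSum.component.of (R := ℝ) (M := fun j => G.layer j) j i ⟨x, hx⟩
  rw [dif_neg hij] at h
  simp [component, G.decompose_of_mem hx, h]

/-- The linear map that multiplies `V_i` by `c i`. -/
def scale (c : ℕ → ℝ) : 𝔤 →ₗ[ℝ] 𝔤 :=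
  ∑ i ∈ Finset.range (G.step + 1), c i • G.component i

theorem scale_of_mem (c : ℕ → ℝ) {i : ℕ} {x : 𝔤} (hx : x ∈ G.layer i) :
    G.scale c x = c i • x := by
  rcases le_or_gt i G.step with hi | hi
  · rw [scale, LinearMap.sum_apply, Finset.sum_eq_single i]
    · rw [LinearMap.smul_apply, G.component_of_mem hx]
    · intro j _ hj
      rw [LinearMap.smul_apply, G.component_of_mem_ne hx hj.symm, smul_zero]
    · intro h
      exact absurd (Finset.mem_range.2 (Nat.lt_succ_of_le hi)) h
  · rw [G.layer_eq_bot i hi, Submodule.mem_bot] at hx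
    rw [hx, map_zero, smul_zero]

theorem dilation_eq_scale (r : ℝ) (x : 𝔤) : G.dilation r x = G.scale (fun i => r ^ i) x := by
  simp [dilation, scale]

/-- Nothing is required at i = 0 because V₀ = 0; this admits the weights i and 1/i of `degree`. -/
theorem scale_comp_scale (c c' : ℕ → ℝ) (h : ∀ i, 1 ≤ i → c i * c' i = 1) (x : 𝔤) :
    G.scale c (G.scale c' x) = x := by
  have : G.scale c ∘ₗ G.scale c' = LinearMap.id := G.linearMap_ext fun i x hx => by
    rcases Nat.eq_zero_or_pos i with rfl | hi
    · simp [G.eq_zero_of_mem_layer_zero hx]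
    · rw [LinearMap.comp_apply, G.scale_of_mem c' hx, map_smul, G.scale_of_mem c hx, smul_smul,
        mul_comm, h i hi, one_smul, LinearMap.id_apply]
  exact LinearMap.congr_fun this x

/-- Bilinear maps that agree on every pair of layers are equal. -/
theorem bilinear_ext {W : Type*} [AddCommGroup W] [Module ℝ W] {S T : 𝔤 →ₗ[ℝ] 𝔤 →ₗ[ℝ] W}
    (h : ∀ i j, ∀ x ∈ G.layer i, ∀ y ∈ G.layer j, S x y = T x y) : S = T :=
  G.linearMap_ext fun i x hx => G.linearMap_ext fun j y hy => h i j x hx y hy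

theorem scale_bracket_of_mul (c : ℕ → ℝ) (h : ∀ i j, c (i + j) = c i * c j) (x y : 𝔤) :
    G.scale c (G.bracket x y) = G.bracket (G.scale c x) (G.scale c y) := by
  have : G.bracket.compr₂ (G.scale c) = G.bracket.compl₁₂ (G.scale c) (G.scale c) :=
    G.bilinear_ext fun i j x hx y hy => by
      simp [G.scale_of_mem c (G.bracket_mem_layer i hx hy), G.scale_of_mem c hx,
        G.scale_of_mem c hy, h, smul_smul, mul_comm]
  exact LinearMap.congr_fun (LinearMap.congr_fun this x) y

theorem dilation_bracket (r : ℝ) (x y : 𝔤) :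
    G.dilation r (G.bracket x y) = G.bracket (G.dilation r x) (G.dilation r y) := by
  simp only [dilation_eq_scale]
  exact G.scale_bracket_of_mul _ (fun i j => pow_add r i j) x y

theorem dilation_dilation_inv {c : ℝ} (hc : c ≠ 0) (x : 𝔤) :
    G.dilation c (G.dilation c⁻¹ x) = x := by
  rw [dilation_eq_scale, dilation_eq_scale]
  refine G.scale_comp_scale _ _ (fun i _ => ?_) x
  rw [← mul_pow, mul_inv_cancel₀ hc, one_pow]

theorem dilation_of_mem_layer_one (c : ℝ) {x : 𝔤} (hx : x ∈ G.layer 1) :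
    G.dilation c x = c • x := by
  rw [dilation_eq_scale, G.scale_of_mem _ hx, pow_one]

theorem component_one_dilation (c : ℝ) (x : 𝔤) :
    G.component 1 (G.dilation c x) = c • G.component 1 x := by
  have : G.component 1 ∘ₗ G.scale (fun i => c ^ i) = c • G.component 1 :=
    G.linearMap_ext fun i x hx => by
      rw [LinearMap.comp_apply, G.scale_of_mem _ hx, map_smul, LinearMap.smul_apply]
      rcases eq_or_ne i 1 with rfl | hi
      · rw [pow_one]
      · rw [G.component_of_mem_ne hx hi, smul_zero, smul_zero]
  rw [dilation_eq_scale]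
  exact LinearMap.congr_fun this x

/-- The derivation that multiplies `V_i` by `i`. -/
def degree : 𝔤 →ₗ[ℝ] 𝔤 := G.scale fun i => (i : ℝ)

theorem degree_bracket (x y : 𝔤) :
    G.degree (G.bracket x y) = G.bracket (G.degree x) y + G.bracket x (G.degree y) := by
  have : G.bracket.compr₂ G.degree = G.bracket.compl₁₂ G.degree LinearMap.id +
      G.bracket.compl₁₂ LinearMap.id G.degree :=
    G.bilinear_ext fun i j x hx y hy => by
      simp [degree, G.scale_of_mem _ (G.bracket_mem_layer i hx hy), G.scale_of_mem _ hx,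
        G.scale_of_mem _ hy, add_smul]
  exact LinearMap.congr_fun (LinearMap.congr_fun this x) y

theorem degree_injective : Function.Injective G.degree :=
  Function.LeftInverse.injective (g := G.scale fun i => (i : ℝ)⁻¹) fun x =>
    G.scale_comp_scale _ _ (fun i hi => inv_mul_cancel₀ (by positivity)) x

/-- The ideal `V_k ⊕ ⋯ ⊕ V_s`. -/
def tail (k : ℕ) : Submodule ℝ 𝔤 := ⨆ (j : ℕ) (_ : k ≤ j), G.layer j

theorem layer_le_tail {k j : ℕ} (h : k ≤ j) : G.layer j ≤ G.tail k :=
  le_iSup₂ (f := fun (j : ℕ) (_ : k ≤ j) => G.layer j) j h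

theorem mem_tail_one (x : 𝔤) : x ∈ G.tail 1 := by
  have : ⨆ i, G.layer i ≤ G.tail 1 := iSup_le fun i => by
    rcases Nat.eq_zero_or_pos i with rfl | hi
    · rw [G.layer_zero]; exact bot_le
    · exact G.layer_le_tail hi
  exact this (by rw [iSup_layer]; trivial)

theorem tail_eq_bot : G.tail (G.step + 1) = ⊥ := by
  simp only [tail, iSup_eq_bot]
  exact fun j hj => G.layer_eq_bot j hj

theorem bracket_mem_tail (x : 𝔤) {k : ℕ} {z : 𝔤} (hz : z ∈ G.tail k) :
    G.bracket x z ∈ G.tail (k + 1) := by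
  have : G.tail k ≤ (G.tail (k + 1)).comap (G.bracket x) := by
    refine iSup₂_le fun j hj z hz => ?_
    have h2 : ⨆ i, G.layer i ≤ (G.tail (k + 1)).comap (G.bracket.flip z) := by
      refine iSup_le fun i x hx => ?_
      rcases Nat.eq_zero_or_pos i with rfl | hi
      · rw [G.eq_zero_of_mem_layer_zero hx]; exact zero_mem _
      · exact G.layer_le_tail (by omega) (G.bracket_mem_layer i hx hz)
    exact h2 (by rw [iSup_layer]; trivial)
  exact this hz

theorem component_one_of_mem_tail {z : 𝔤} (hz : z ∈ G.tail 2) : G.component 1 z = 0 := by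
  have : G.tail 2 ≤ LinearMap.ker (G.component 1) :=
    iSup₂_le fun j hj z hz => G.component_of_mem_ne hz (by omega)
  exact this hz

theorem component_one_bracket (x y : 𝔤) : G.component 1 (G.bracket x y) = 0 :=
  G.component_one_of_mem_tail (G.bracket_mem_tail x (G.mem_tail_one y))

variable [FiniteDimensional ℝ 𝔤]

/-! ### The adjoint representation and a faithful nilpotent representation -/

/-- The adjoint representation, with values in the bounded operators. -/
def adL : 𝔤 →ₗ[ℝ] (𝔤 →L[ℝ] 𝔤) :=
  LinearMap.toContinuousLinearMap.toLinearMap ∘ₗ G.bracket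

@[simp] theorem adL_apply (x y : 𝔤) : G.adL x y = G.bracket x y := rfl

theorem adL_pow_mem_tail (x y : 𝔤) (k : ℕ) : (G.adL x ^ k) y ∈ G.tail (k + 1) := by
  induction k with
  | zero => simpa using G.mem_tail_one y
  | succ k ih =>
    rw [pow_succ']
    exact G.bracket_mem_tail x ih

theorem adL_pow_eq_zero (x : 𝔤) : G.adL x ^ (G.step + 1) = 0 := by
  ext y
  have := G.bracket_mem_tail x (G.adL_pow_mem_tail x y G.step)
  have h2 : G.tail (G.step + 1 + 1) ≤ G.tail (G.step + 1) :=
    iSup₂_le fun j hj => G.layer_le_tail (by omega)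
  have h3 := h2 this
  rw [G.tail_eq_bot, Submodule.mem_bot] at h3
  rw [pow_succ']
  exact h3

theorem adL_bracket (x y : 𝔤) :
    G.adL (G.bracket x y) = G.adL x * G.adL y - G.adL y * G.adL x := by
  ext z
  exact G.bracket_bracket x y z

/-- The adjoint representation of `ℝ D ⊕ 𝔤` restricted to `𝔤`, where `D` is the derivation that
multiplies `V_i` by `i`. Unlike the adjoint representation of `𝔤`, it is faithful. -/
def extAd : 𝔤 →ₗ[ℝ] (ℝ × 𝔤 →L[ℝ] ℝ × 𝔤) :=
  LinearMap.toContinuousLinearMap.toLinearMap ∘ₗ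
    LinearMap.mk₂ ℝ (fun x v => ((0 : ℝ), G.bracket x v.2 - v.1 • G.degree x))
      (fun x y v => by simp; abel) (fun c x v => by simp [smul_sub, smul_comm c])
      (fun x v w => by simp [add_smul]; abel) (fun c x v => by simp [smul_sub, mul_smul])

@[simp] theorem extAd_apply (x : 𝔤) (v : ℝ × 𝔤) :
    G.extAd x v = (0, G.bracket x v.2 - v.1 • G.degree x) := rfl

theorem extAd_bracket (x y : 𝔤) :
    G.extAd (G.bracket x y) = G.extAd x * G.extAd y - G.extAd y * G.extAd x := by
  refine ContinuousLinearMap.ext fun v => ?_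
  simp only [sub_apply, mul_apply_eq_comp, extAd_apply,
    G.bracket_bracket, G.degree_bracket, map_sub, map_smul, zero_smul, sub_zero, Prod.mk_sub_mk]
  rw [G.bracket_neg_swap (G.degree x) y]
  simp only [smul_add, smul_neg]
  congr 1
  abel

theorem extAd_pow_apply (x : 𝔤) (v : ℝ × 𝔤) (k : ℕ) :
    ((G.extAd x ^ (k + 1)) v).1 = 0 ∧ ((G.extAd x ^ (k + 1)) v).2 ∈ G.tail (k + 1) := by
  induction k with
  | zero => exact ⟨rfl, G.mem_tail_one _⟩
  | succ k ih =>
    rw [pow_succ', mul_apply_eq_comp, extAd_apply, ih.1]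
    simpa using G.bracket_mem_tail x ih.2

theorem extAd_pow_eq_zero (x : 𝔤) : G.extAd x ^ (G.step + 1) = 0 := by
  refine ContinuousLinearMap.ext fun v => ?_
  obtain ⟨h1, h2⟩ := G.extAd_pow_apply x v G.step
  rw [G.tail_eq_bot, Submodule.mem_bot] at h2
  exact Prod.ext h1 h2

/-- Evaluation at D = (1, 0) gives -`degree x`, which detects even central x. -/
theorem extAd_injective : Function.Injective G.extAd := fun x y h => by
  have := congrArg (fun T : ℝ × 𝔤 →L[ℝ] ℝ × 𝔤 => (T (1, 0)).2) h
  simpa using G.degree_injective (by simpa using this)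

end CarnotGroup

end

/-! ### Truncated series and the Baker-Campbell-Hausdorff formula in representations -/

noncomputable section

/-- The truncated power series of `ψ(M) = M log M / (M - 1)` at `M = 1`, in an arbitrary algebra. -/
def psiSeries {A : Type*} [Ring A] [Algebra ℝ A] (m : ℕ) (M : A) : A :=
  1 - ∑ n ∈ Finset.range m, (((n : ℝ) + 1) * ((n : ℝ) + 2))⁻¹ • (1 - M) ^ (n + 1)

theorem contDiff_psiSeries {A : Type*} [NormedRing A] [NormedAlgebra ℝ A] (m : ℕ) :
    ContDiff ℝ 1 (psiSeries m : A → A) := by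
  unfold psiSeries
  fun_prop

/-- The truncated logarithm series. -/
def logSeries {A : Type*} [Ring A] [Algebra ℝ A] (m : ℕ) (M : A) : A :=
  -∑ n ∈ Finset.range (m + 1), ((n : ℝ) + 1)⁻¹ • (1 - M) ^ (n + 1)

theorem contDiff_logSeries {A : Type*} [NormedRing A] [NormedAlgebra ℝ A] (m : ℕ) :
    ContDiff ℝ 1 (logSeries m : A → A) := by
  unfold logSeries
  fun_prop

theorem logSeries_exp {A : Type*} [NormedRing A] [NormedAlgebra ℝ A] [CompleteSpace A] {N : A}
    {m : ℕ} (hN : N ^ (m + 1) = 0) : logSeries m (NormedSpace.exp N) = N := by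
  rw [logSeries, NormedSpace.sum_one_sub_exp_pow hN, neg_neg]

namespace CarnotGroup

variable {𝔤 : Type*} [NormedAddCommGroup 𝔤] [NormedSpace ℝ 𝔤] (G : CarnotGroup 𝔤)

/-! ### Truncated series as exponentials of bounded operators -/

theorem psi_apply_eq_psiSeries (M : 𝔤 →L[ℝ] 𝔤) (v : 𝔤) :
    G.psi (M : 𝔤 →ₗ[ℝ] 𝔤) v = psiSeries G.step M v := by
  have hpow : ∀ (n : ℕ) (w : 𝔤),
      ((1 - (M : 𝔤 →ₗ[ℝ] 𝔤) : Module.End ℝ 𝔤) ^ n) w = ((1 - M) ^ n) w := fun n => by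
    induction n with
    | zero => intro w; simp
    | succ n ih => intro w; rw [pow_succ, pow_succ, Module.End.mul_apply, ih]; simp
  rw [psi, psiSeries, LinearMap.sub_apply, LinearMap.sum_apply, sub_apply,
    _root_.sum_apply,
    ← Finset.Ico_add_one_right_eq_Icc, Finset.sum_Ico_eq_sum_range, Nat.add_sub_cancel]
  congr 1
  refine Finset.sum_congr rfl fun n _ => ?_
  rw [LinearMap.smul_apply, smul_apply, hpow, add_comm 1 n]
  push_cast
  congr 3
  ring

variable [FiniteDimensional ℝ 𝔤]

theorem expAd_eq_exp (x : 𝔤) : G.expAd x = (NormedSpace.exp (G.adL x) : 𝔤 →L[ℝ] 𝔤) := by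
  have hpow : ∀ (n : ℕ) (w : 𝔤), (G.ad x ^ n) w = (G.adL x ^ n) w := fun n => by
    induction n with
    | zero => intro w; rfl
    | succ n ih => intro w; rw [pow_succ, pow_succ, Module.End.mul_apply, ih]; rfl
  ext v
  rw [NormedSpace.exp_eq_sum_of_pow_eq_zero (G.adL_pow_eq_zero x), expAd, LinearMap.sum_apply,
    ContinuousLinearMap.coe_coe, _root_.sum_apply]
  exact Finset.sum_congr rfl fun k _ => congrArg _ (hpow k v)

theorem mul_eq (x y : 𝔤) : G.mul x y = x + ∫ t in (0 : ℝ)..1,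
    psiSeries G.step (NormedSpace.exp (G.adL x) * NormedSpace.exp (t • G.adL y)) y := by
  simp only [mul, expAd_eq_exp, ← psi_apply_eq_psiSeries, map_smul]
  rfl

/-! ### The derivative of the exponential in a representation -/

section Representation

variable {A : Type*} [NormedRing A] [NormedAlgebra ℝ A] [CompleteSpace A] {σ : 𝔤 →ₗ[ℝ] A}
  (hσ : ∀ x y, σ (G.bracket x y) = σ x * σ y - σ y * σ x)
include hσ

/-- This is Ad(e^{-z}) = e^{-ad z}: the curve e^{τσ(z)} σ(e^{-τ ad z} w) e^{-τσ(z)} has zero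
derivative. -/
theorem exp_neg_mul_mul_exp (z w : 𝔤) :
    NormedSpace.exp (-σ z) * σ w * NormedSpace.exp (σ z) =
      σ (NormedSpace.exp (-G.adL z) w) := by
  have hσd : ∀ (v : ℝ → 𝔤) (v' : 𝔤) (τ : ℝ), HasDerivAt v v' τ →
      HasDerivAt (fun τ => σ (v τ)) (σ v') τ := fun v v' τ hv =>
    (LinearMap.toContinuousLinearMap σ).hasFDerivAt.comp_hasDerivAt τ hv
  have hd : ∀ τ : ℝ, HasDerivAt (fun τ : ℝ => NormedSpace.exp (τ • σ z) *
      σ (NormedSpace.exp (τ • (-G.adL z)) w) * NormedSpace.exp (τ • (-σ z))) 0 τ := fun τ => by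
    have h1 := hasDerivAt_exp_smul_const (𝕂 := ℝ) (σ z) τ
    have h2 := hasDerivAt_exp_smul_const' (𝕂 := ℝ) (-σ z) τ
    have h3 := hσd _ _ τ (((ContinuousLinearMap.apply ℝ 𝔤 w).hasFDerivAt).comp_hasDerivAt τ
      (hasDerivAt_exp_smul_const' (𝕂 := ℝ) (-G.adL z) τ))
    refine ((h1.fun_mul h3).fun_mul h2).congr_deriv ?_
    simp only [Function.comp_def, ContinuousLinearMap.apply_apply, mul_apply_eq_comp,
      neg_apply, adL_apply, map_neg, hσ]
    noncomm_ring
  have := is_const_of_deriv_eq_zero (fun τ => (hd τ).differentiableAt) (fun τ => (hd τ).deriv) 1 0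
  simp only [one_smul, zero_smul, NormedSpace.exp_zero, one_mul, mul_one, one_apply_eq_self] at this
  rw [← this, mul_assoc, mul_assoc, NormedSpace.exp_neg_mul_exp_self, mul_one, ← mul_assoc,
    NormedSpace.exp_neg_mul_exp_self, one_mul]

/-- Pulling e^{σ(Z)} out of the integral for the derivative leaves conjugates of σ(Z'), that is,
σ(e^{-s ad Z} Z'). The resulting operator on Z' is the inverse of ψ(e^{ad Z}). -/
theorem hasDerivAt_exp_representation {Z : ℝ → 𝔤} {Z' : 𝔤} {t : ℝ} (hZ : HasDerivAt Z Z' t) :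
    HasDerivAt (fun t => NormedSpace.exp (σ (Z t))) (NormedSpace.exp (σ (Z t)) *
      σ ((∫ s in (0 : ℝ)..1, NormedSpace.exp (-(s • G.adL (Z t)))) Z')) t := by
  have hc := NormedSpace.continuous_exp_real (A := 𝔤 →L[ℝ] 𝔤)
  have h1 : HasDerivAt (fun t => σ (Z t)) (σ Z') t :=
    (LinearMap.toContinuousLinearMap σ).hasFDerivAt.comp_hasDerivAt t hZ
  refine (NormedSpace.hasDerivAt_exp_comp h1).congr_deriv ?_
  let T : (𝔤 →L[ℝ] 𝔤) →L[ℝ] A := (ContinuousLinearMap.mul ℝ A (NormedSpace.exp (σ (Z t)))).comp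
    ((LinearMap.toContinuousLinearMap σ).comp (ContinuousLinearMap.apply ℝ 𝔤 Z'))
  have h2 := T.intervalIntegral_comp_comm (μ := volume) (Continuous.intervalIntegrable
    (show Continuous fun s : ℝ => NormedSpace.exp (-(s • G.adL (Z t))) by fun_prop) 0 1)
  refine Eq.trans (intervalIntegral.integral_congr fun s _ => ?_) h2
  have h3 := G.exp_neg_mul_mul_exp hσ (s • Z t) Z'
  simp only [map_smul] at h3
  have h4 : NormedSpace.exp ((1 - s) • σ (Z t)) =
      NormedSpace.exp (σ (Z t)) * NormedSpace.exp (-(s • σ (Z t))) := by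
    rw [sub_eq_add_neg, NormedSpace.exp_add_smul, one_smul, neg_smul]
  simp only [h4, T, ContinuousLinearMap.comp_apply, ContinuousLinearMap.mul_apply',
    ContinuousLinearMap.apply_apply, LinearMap.coe_toContinuousLinearMap', ← h3, mul_assoc]

end Representation

/-! ### The Baker-Campbell-Hausdorff formula -/

/-- The velocity of the Baker-Campbell-Hausdorff curve `t ↦ x · (t y)`. -/
def bchVelocity (x y : 𝔤) (t : ℝ) : 𝔤 :=
  psiSeries G.step (NormedSpace.exp (G.adL x) * NormedSpace.exp (t • G.adL y)) y

/-- The Baker-Campbell-Hausdorff curve `t ↦ x · (t y)`. -/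
def bchCurve (x y : 𝔤) (t : ℝ) : 𝔤 := x + ∫ s in (0 : ℝ)..t, G.bchVelocity x y s

theorem continuous_bchVelocity (x y : 𝔤) : Continuous (G.bchVelocity x y) := by
  have h1 := NormedSpace.continuous_exp_real (A := 𝔤 →L[ℝ] 𝔤)
  have h2 := (contDiff_psiSeries (A := 𝔤 →L[ℝ] 𝔤) G.step).continuous
  unfold bchVelocity
  fun_prop

theorem hasDerivAt_bchCurve (x y : 𝔤) (t : ℝ) :
    HasDerivAt (G.bchCurve x y) (G.bchVelocity x y t) t :=
  (((G.continuous_bchVelocity x y).integral_hasStrictDerivAt 0 t).hasDerivAt).const_add x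

theorem integral_exp_mul_psiSeries (z : 𝔤) :
    (∫ s in (0 : ℝ)..1, NormedSpace.exp (-(s • G.adL z))) *
      psiSeries G.step (NormedSpace.exp (G.adL z)) = 1 :=
  NormedSpace.integral_exp_mul_psi (G.adL_pow_eq_zero z)

theorem exists_lipschitz_psiSeries {A : Type*} [NormedRing A] [NormedAlgebra ℝ A]
    [FiniteDimensional ℝ A] (m : ℕ) (R : ℝ) :
    ∃ K : NNReal, LipschitzOnWith K (psiSeries m : A → A) (Metric.closedBall 0 R) := by
  have := FiniteDimensional.proper ℝ A
  exact (contDiff_psiSeries m).contDiffOn.exists_lipschitzOnWith (by decide)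
    (convex_closedBall 0 R) (isCompact_closedBall 0 R)

/-- The velocity involves ψ(b) with b = e^{ad x} e^{t ad y}, not ψ(a) with a = e^{ad Z}. While b' =
b ad y, the equation for a has an extra term linear in ψ(b) - ψ(a). As ψ is Lipschitz on bounded
sets, |(a - b)'| ≤ C |a - b|, and Gronwall's inequality gives a = b. -/
theorem exp_adL_bchCurve (x y : 𝔤) {t : ℝ} (ht : t ∈ Set.Icc (0 : ℝ) 1) :
    NormedSpace.exp (G.adL (G.bchCurve x y t)) =
      NormedSpace.exp (G.adL x) * NormedSpace.exp (t • G.adL y) := by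
  have hexp := NormedSpace.continuous_exp_real (A := 𝔤 →L[ℝ] 𝔤)
  have hZ : Continuous (G.bchCurve x y) :=
    continuous_iff_continuousAt.2 fun t => (G.hasDerivAt_bchCurve x y t).continuousAt
  have hadc : Continuous G.adL := LinearMap.continuous_of_finiteDimensional _
  set a : ℝ → 𝔤 →L[ℝ] 𝔤 := fun t => NormedSpace.exp (G.adL (G.bchCurve x y t)) with ha
  set b : ℝ → 𝔤 →L[ℝ] 𝔤 := fun t => NormedSpace.exp (G.adL x) * NormedSpace.exp (t • G.adL y)
    with hb
  set κ : ℝ → 𝔤 →L[ℝ] 𝔤 := fun t =>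
    ∫ s in (0 : ℝ)..1, NormedSpace.exp (-(s • G.adL (G.bchCurve x y t))) with hκ
  have hac : Continuous a := by fun_prop
  have hbc : Continuous b := by fun_prop
  have hκc : Continuous κ :=
    intervalIntegral.continuous_parametric_intervalIntegral_of_continuous' (by fun_prop) _ _
  have had : ∀ t, HasDerivAt a
      (a t * G.adL (y + κ t ((psiSeries G.step (b t) - psiSeries G.step (a t)) y))) t := fun t => by
    refine (G.hasDerivAt_exp_representation G.adL_bracket
      (G.hasDerivAt_bchCurve x y t)).congr_deriv ?_
    have h := congrArg (fun T : 𝔤 →L[ℝ] 𝔤 => T y) (G.integral_exp_mul_psiSeries (G.bchCurve x y t))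
    have h : κ t (psiSeries G.step (a t) y) = y := h
    rw [sub_apply, map_sub, h, add_sub_cancel]
    rfl
  have hbd : ∀ t, HasDerivAt b (b t * G.adL y) t := fun t => by
    have := (hasDerivAt_exp_smul_const (𝕂 := ℝ) (G.adL y) t).const_mul (NormedSpace.exp (G.adL x))
    simpa only [hb, mul_assoc] using this
  obtain ⟨Ca, hCa⟩ := isCompact_Icc.exists_bound_of_continuousOn
    (hac.continuousOn (s := Set.Icc (0 : ℝ) 1))
  obtain ⟨Cb, hCb⟩ := isCompact_Icc.exists_bound_of_continuousOn
    (hbc.continuousOn (s := Set.Icc (0 : ℝ) 1))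
  obtain ⟨Cκ, hCκ⟩ := isCompact_Icc.exists_bound_of_continuousOn
    (hκc.continuousOn (s := Set.Icc (0 : ℝ) 1))
  obtain ⟨K, hK⟩ := exists_lipschitz_psiSeries (A := 𝔤 →L[ℝ] 𝔤) G.step (max Ca Cb)
  set adc : 𝔤 →L[ℝ] (𝔤 →L[ℝ] 𝔤) := LinearMap.toContinuousLinearMap G.adL with hadc'
  have key := eq_zero_of_abs_deriv_le_mul_abs_self_of_eq_zero_right
    (f := fun t => a t - b t) (a := 0) (b := 1)
    (K := ‖G.adL y‖ + Ca * (‖adc‖ * (Cκ * (K * ‖y‖))))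
    (hac.sub hbc).continuousOn (fun t _ => ((had t).sub (hbd t)).hasDerivWithinAt)
    (by simp [ha, hb, bchCurve, NormedSpace.exp_zero]) ?_ t ht
  · exact sub_eq_zero.1 key
  · intro t ht
    have ht : t ∈ Set.Icc (0 : ℝ) 1 := ⟨ht.1, ht.2.le⟩
    have h1 : ‖psiSeries G.step (b t) - psiSeries G.step (a t)‖ ≤ K * ‖a t - b t‖ := by
      have := hK.norm_sub_le
        (mem_closedBall_zero_iff.2 ((hCb t ht).trans (le_max_right Ca Cb)))
        (mem_closedBall_zero_iff.2 ((hCa t ht).trans (le_max_left Ca Cb)))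
      rwa [norm_sub_rev (b t)] at this
    have h2 : ‖κ t ((psiSeries G.step (b t) - psiSeries G.step (a t)) y)‖ ≤
        Cκ * (K * ‖a t - b t‖ * ‖y‖) := by
      refine (κ t).le_of_opNorm_le_of_le (hCκ t ht) ?_
      exact ContinuousLinearMap.le_of_opNorm_le _ h1 y
    have h3 : ‖G.adL (κ t ((psiSeries G.step (b t) - psiSeries G.step (a t)) y))‖ ≤
        ‖adc‖ * (Cκ * (K * ‖a t - b t‖ * ‖y‖)) := adc.le_opNorm_of_le h2
    have h4 : a t * G.adL (y + κ t ((psiSeries G.step (b t) - psiSeries G.step (a t)) y)) -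
        b t * G.adL y = (a t - b t) * G.adL y +
        a t * G.adL (κ t ((psiSeries G.step (b t) - psiSeries G.step (a t)) y)) := by
      rw [map_add]; noncomm_ring
    rw [h4]
    calc _ ≤ ‖a t - b t‖ * ‖G.adL y‖ + Ca * (‖adc‖ * (Cκ * (K * ‖a t - b t‖ * ‖y‖))) := by
          refine (norm_add_le _ _).trans (add_le_add (norm_mul_le _ _) ?_)
          refine (norm_mul_le _ _).trans ?_
          exact mul_le_mul (hCa t ht) h3 (norm_nonneg _) ((norm_nonneg _).trans (hCa t ht))
      _ = _ := by ring

/-- The Baker-Campbell-Hausdorff product is the product of exponentials in every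
representation. -/
theorem exp_representation_mul {A : Type*} [NormedRing A] [NormedAlgebra ℝ A] [CompleteSpace A]
    {σ : 𝔤 →ₗ[ℝ] A} (hσ : ∀ x y, σ (G.bracket x y) = σ x * σ y - σ y * σ x) (x y : 𝔤) :
    NormedSpace.exp (σ (G.mul x y)) = NormedSpace.exp (σ x) * NormedSpace.exp (σ y) := by
  have hd : ∀ t ∈ Set.Ico (0 : ℝ) 1, HasDerivWithinAt (fun t : ℝ =>
      NormedSpace.exp (σ (G.bchCurve x y t)) * NormedSpace.exp (t • (-σ y))) 0 (Set.Ici t) t := by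
    intro t ht
    have h := congrArg (fun T : 𝔤 →L[ℝ] 𝔤 => T y) (G.integral_exp_mul_psiSeries (G.bchCurve x y t))
    -- The velocity is now known to be ψ(e^{ad Z}) y, so e^{σ(Z)} has derivative e^{σ(Z)} σ(y).
    rw [G.exp_adL_bchCurve x y ⟨ht.1, ht.2.le⟩] at h
    have h1 := G.hasDerivAt_exp_representation hσ (G.hasDerivAt_bchCurve x y t)
    rw [show (∫ s in (0 : ℝ)..1, NormedSpace.exp (-(s • G.adL (G.bchCurve x y t))))
      (G.bchVelocity x y t) = y from h] at h1
    refine ((h1.mul (hasDerivAt_exp_smul_const' (𝕂 := ℝ) (-σ y) t)).congr_deriv ?_).hasDerivWithinAt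
    noncomm_ring
  have hc : ContinuousOn (fun t : ℝ =>
      NormedSpace.exp (σ (G.bchCurve x y t)) * NormedSpace.exp (t • (-σ y))) (Set.Icc 0 1) := by
    have hexp := NormedSpace.continuous_exp_real (A := A)
    have hZ : Continuous (G.bchCurve x y) :=
      continuous_iff_continuousAt.2 fun t => (G.hasDerivAt_bchCurve x y t).continuousAt
    have hσc : Continuous σ := LinearMap.continuous_of_finiteDimensional _
    fun_prop
  have h := constant_of_has_deriv_right_zero hc hd 1 (by simp)
  rw [show G.bchCurve x y 1 = G.mul x y from (G.mul_eq x y).symm] at h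
  simp only [one_smul, zero_smul, NormedSpace.exp_zero, mul_one, bchCurve,
    intervalIntegral.integral_same, add_zero] at h
  rw [← h, mul_assoc, NormedSpace.exp_neg_mul_exp_self, mul_one]

end CarnotGroup

end

noncomputable section

namespace CarnotGroup

variable {𝔤 : Type*} [NormedAddCommGroup 𝔤] [NormedSpace ℝ 𝔤] [FiniteDimensional ℝ 𝔤]
  (G : CarnotGroup 𝔤)

/-! ### The group laws -/

/-- The faithful unipotent representation of the group. -/
def unip (x : 𝔤) : ℝ × 𝔤 →L[ℝ] ℝ × 𝔤 := NormedSpace.exp (G.extAd x)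

theorem logSeries_unip (x : 𝔤) : logSeries G.step (G.unip x) = G.extAd x :=
  logSeries_exp (G.extAd_pow_eq_zero x)

/-- The logarithm recovers `extAd x`, hence x. The group laws below are pulled back from operators
along this injection. -/
theorem unip_injective : Function.Injective G.unip := fun x y h =>
  G.extAd_injective (by rw [← logSeries_unip, h, logSeries_unip])

theorem unip_mul (x y : 𝔤) : G.unip (G.mul x y) = G.unip x * G.unip y :=
  G.exp_representation_mul G.extAd_bracket x y

theorem unip_zero : G.unip 0 = 1 := by
  rw [unip, map_zero, NormedSpace.exp_zero]

theorem mul_assoc' (x y z : 𝔤) : G.mul (G.mul x y) z = G.mul x (G.mul y z) :=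
  G.unip_injective (by simp only [unip_mul, mul_assoc])

theorem zero_mul' (x : 𝔤) : G.mul 0 x = x :=
  G.unip_injective (by rw [unip_mul, unip_zero, one_mul])

theorem mul_zero' (x : 𝔤) : G.mul x 0 = x :=
  G.unip_injective (by rw [unip_mul, unip_zero, mul_one])

theorem smul_mul_smul (E : 𝔤) (s t : ℝ) : G.mul (s • E) (t • E) = (s + t) • E :=
  G.unip_injective (by
    rw [unip_mul, unip, unip, unip, map_smul, map_smul, map_smul]
    exact (NormedSpace.exp_add_smul _ s t).symm)

theorem neg_mul_self (x : 𝔤) : G.mul (-x) x = 0 := by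
  simpa using G.smul_mul_smul x (-1) 1

theorem mul_neg_self (x : 𝔤) : G.mul x (-x) = 0 := by
  simpa using G.smul_mul_smul x 1 (-1)

theorem neg_mul_cancel_left (x y : 𝔤) : G.mul (-x) (G.mul x y) = y := by
  rw [← mul_assoc', neg_mul_self, zero_mul']

theorem mul_neg_cancel_left (x y : 𝔤) : G.mul x (G.mul (-x) y) = y := by
  rw [← mul_assoc', mul_neg_self, zero_mul']

/-- This form, with R a left inverse of `extAd`, makes the product visibly smooth without
differentiating the defining integral. -/
theorem exists_mul_eq_logSeries : ∃ R : (ℝ × 𝔤 →L[ℝ] ℝ × 𝔤) →ₗ[ℝ] 𝔤, ∀ x y,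
    G.mul x y = R (logSeries G.step (G.unip x * G.unip y)) := by
  obtain ⟨R, hR⟩ := G.extAd.exists_leftInverse_of_injective
    (LinearMap.ker_eq_bot.2 G.extAd_injective)
  refine ⟨R, fun x y => ?_⟩
  rw [← unip_mul, logSeries_unip]
  exact (LinearMap.congr_fun hR (G.mul x y)).symm

theorem contDiff_unip : ContDiff ℝ 1 G.unip :=
  (NormedSpace.contDiff_exp_real.of_le (by simp)).comp
    (LinearMap.toContinuousLinearMap G.extAd).contDiff

theorem contDiff_mul_left (g : 𝔤) : ContDiff ℝ 1 (G.mul g) := by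
  obtain ⟨R, hR⟩ := G.exists_mul_eq_logSeries
  rw [show G.mul g = fun y => R (logSeries G.step (G.unip g * G.unip y)) from funext (hR g)]
  exact (LinearMap.toContinuousLinearMap R).contDiff.comp
    ((contDiff_logSeries G.step).comp (contDiff_const.mul G.contDiff_unip))

theorem differentiable_mul_left (g : 𝔤) : Differentiable ℝ (G.mul g) :=
  (G.contDiff_mul_left g).differentiable (by simp)

theorem mul_eq_add_integral (x y : 𝔤) :
    G.mul x y = x + ∫ t in (0 : ℝ)..1, G.bchVelocity x y t :=
  G.mul_eq x y

/-- The dilation intertwines ad x with ad (δx), hence also the exponentials and ψ. Intertwining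
needs no inverse, so c = 0 is allowed. -/
theorem dilation_mul {c : ℝ} (x y : 𝔤) :
    G.dilation c (G.mul x y) = G.mul (G.dilation c x) (G.dilation c y) := by
  set δ : 𝔤 →L[ℝ] 𝔤 := LinearMap.toContinuousLinearMap (G.scale fun i => c ^ i) with hδ
  have hd : ∀ x, G.dilation c x = δ x := fun x => G.dilation_eq_scale c x
  have hs : ∀ x, SemiconjBy δ (G.adL x) (G.adL (δ x)) := fun x => by
    ext z
    simpa [hd] using G.dilation_bracket c x z
  have hse : ∀ (x : 𝔤) (t : ℝ), SemiconjBy δ (NormedSpace.exp (t • G.adL x))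
      (NormedSpace.exp (t • G.adL (δ x))) := fun x t => by
    let := NormedAlgebra.restrictScalars ℚ ℝ (𝔤 →L[ℝ] 𝔤)
    exact SemiconjBy.exp_right ((hs x).smul_right t)
  have hψ : ∀ M N : 𝔤 →L[ℝ] 𝔤, SemiconjBy δ M N →
      SemiconjBy δ (psiSeries G.step M) (psiSeries G.step N) := fun M N h => by
    refine (SemiconjBy.one_right δ).sub_right ?_
    have hp : ∀ n : ℕ, δ * ((1 - M) ^ n) = (1 - N) ^ n * δ := fun n =>
      (((SemiconjBy.one_right δ).sub_right h).pow_right n).eq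
    simp only [SemiconjBy, Finset.mul_sum, Finset.sum_mul, mul_smul_comm, smul_mul_assoc, hp]
  rw [hd, hd, hd, mul_eq_add_integral, mul_eq_add_integral, map_add, ← δ.intervalIntegral_comp_comm
    ((G.continuous_bchVelocity x y).intervalIntegrable 0 1)]
  congr 1
  refine intervalIntegral.integral_congr fun t _ => ?_
  have h1 := (hse x 1).mul_right (hse y t)
  simp only [one_smul] at h1
  exact congrArg (fun T : 𝔤 →L[ℝ] 𝔤 => T y) (hψ _ _ h1).eq

/-- The projection onto the horizontal layer is a homomorphism. -/
theorem component_one_mul (x y : 𝔤) :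
    G.component 1 (G.mul x y) = G.component 1 x + G.component 1 y := by
  set q : 𝔤 →L[ℝ] 𝔤 := LinearMap.toContinuousLinearMap (G.component 1) with hq
  have hqd : ∀ x, G.component 1 x = q x := fun x => rfl
  -- The projection q kills brackets, so q e^{ad x} = q and q ψ = q: the integrand projects to the
  -- constant q y.
  have hs : ∀ x : 𝔤, q * G.adL x = 0 := fun x => by
    ext z
    exact G.component_one_bracket x z
  have he : ∀ x : 𝔤, q * NormedSpace.exp (G.adL x) = q := fun x => by
    rw [NormedSpace.exp_eq_sum_of_pow_eq_zero (G.adL_pow_eq_zero x), Finset.sum_range_succ', mul_add,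
      Finset.mul_sum, Finset.sum_eq_zero]
    · simp
    · intro k _
      rw [mul_smul_comm, pow_succ', ← mul_assoc, hs, zero_mul, smul_zero]
  have hψ : ∀ M : 𝔤 →L[ℝ] 𝔤, q * M = q → q * psiSeries G.step M = q := fun M h => by
    rw [psiSeries, mul_sub, Finset.mul_sum, Finset.sum_eq_zero, mul_one, sub_zero]
    intro k _
    rw [mul_smul_comm, pow_succ', ← mul_assoc, mul_sub, h, mul_one, sub_self, zero_mul, smul_zero]
  rw [hqd, hqd, hqd, mul_eq_add_integral, map_add, ← q.intervalIntegral_comp_comm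
    ((G.continuous_bchVelocity x y).intervalIntegrable 0 1)]
  congr 1
  have : ∀ t : ℝ, q (psiSeries G.step
      (NormedSpace.exp (G.adL x) * NormedSpace.exp (t • G.adL y)) y) = q y := fun t => by
    refine congrArg (fun T : 𝔤 →L[ℝ] 𝔤 => T y) (hψ _ ?_)
    rw [← mul_assoc, he, ← map_smul, he]
  simp [bchVelocity, this]

/-! ### Left invariant vector fields -/

theorem hasDerivAt_mul_smul (E p : 𝔤) :
    HasDerivAt (fun t : ℝ => G.mul p (G.exp (t • E))) (fderiv ℝ (G.mul p) 0 E) 0 := by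
  have h1 : HasFDerivAt (G.mul p) (fderiv ℝ (G.mul p) 0) ((0 : ℝ) • E) := by
    rw [zero_smul]; exact (G.differentiable_mul_left p 0).hasFDerivAt
  have h2 : HasDerivAt (fun t : ℝ => t • E) E 0 := by
    simpa using (hasDerivAt_id (0 : ℝ)).smul_const E
  exact HasFDerivAt.comp_hasDerivAt (l := G.mul p) (f := fun t : ℝ => t • E) 0 h1 h2

theorem leftInvariantField_eq (E p : 𝔤) :
    G.leftInvariantField E p = fderiv ℝ (G.mul p) 0 E :=
  (G.hasDerivAt_mul_smul E p).deriv

theorem fderiv_mul_leftInvariantField (g E p : 𝔤) :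
    fderiv ℝ (G.mul g) p (G.leftInvariantField E p) = G.leftInvariantField E (G.mul g p) := by
  have h1 : HasFDerivAt (G.mul g) (fderiv ℝ (G.mul g) p) (G.mul p (G.exp ((0 : ℝ) • E))) := by
    rw [exp, zero_smul, mul_zero']; exact (G.differentiable_mul_left g p).hasFDerivAt
  have h2 := h1.comp_hasDerivAt 0 (G.hasDerivAt_mul_smul E p)
  rw [leftInvariantField_eq, leftInvariantField_eq]
  refine h2.unique ?_
  simpa only [Function.comp_def, ← mul_assoc'] using G.hasDerivAt_mul_smul E (G.mul g p)

theorem dilation_leftInvariantField (c : ℝ) {E : 𝔤} (hE : E ∈ G.layer 1) (p : 𝔤) :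
    G.dilation c (G.leftInvariantField E p) = c • G.leftInvariantField E (G.dilation c p) := by
  set δ : 𝔤 →L[ℝ] 𝔤 := LinearMap.toContinuousLinearMap (G.scale fun i => c ^ i) with hδ
  have hd : ∀ x, G.dilation c x = δ x := fun x => G.dilation_eq_scale c x
  have h1 := δ.hasFDerivAt.comp_hasDerivAt 0 (G.hasDerivAt_mul_smul E p)
  rw [leftInvariantField_eq, leftInvariantField_eq, hd, ← map_smul]
  refine h1.unique ?_
  have h2 := G.hasDerivAt_mul_smul (c • E) (G.dilation c p)
  refine h2.congr_of_eventuallyEq (Eventually.of_forall fun t => ?_)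
  simp only [Function.comp_def, ← hd, exp, dilation_mul]
  rw [G.dilation_of_mem_layer_one c (Submodule.smul_mem _ t hE), smul_comm]

theorem component_one_leftInvariantField {E : 𝔤} (hE : E ∈ G.layer 1) (p : 𝔤) :
    G.component 1 (G.leftInvariantField E p) = E := by
  have h1 := (LinearMap.toContinuousLinearMap (G.component 1)).hasFDerivAt.comp_hasDerivAt 0
    (G.hasDerivAt_mul_smul E p)
  rw [leftInvariantField_eq]
  refine h1.unique ?_
  have h2 : HasDerivAt (fun t : ℝ => G.component 1 p + t • E) E 0 := by
    simpa using ((hasDerivAt_id (0 : ℝ)).smul_const E).const_add (G.component 1 p)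
  refine h2.congr_of_eventuallyEq (Eventually.of_forall fun t => ?_)
  simp [exp, component_one_mul, G.component_of_mem hE]

/-- Lines through 0 are one-parameter subgroups, so horizontal segments through 0 are horizontal
curves. -/
theorem leftInvariantField_smul_self (E : 𝔤) (s : ℝ) : G.leftInvariantField E (s • E) = E := by
  rw [leftInvariantField_eq]
  refine (G.hasDerivAt_mul_smul E (s • E)).unique ?_
  simp only [exp, smul_mul_smul]
  simpa using ((hasDerivAt_id (0 : ℝ)).const_add s).smul_const E

end CarnotGroup

end

noncomputable section

/-! ### Absolutely continuous curves under C¹ maps and time reversal -/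

namespace AbsolutelyContinuousOnInterval

theorem comp_lipschitzOnWith {X Y : Type*} [PseudoMetricSpace X] [PseudoMetricSpace Y]
    {f : ℝ → X} {a b : ℝ} (hf : AbsolutelyContinuousOnInterval f a b) {F : X → Y} {K : NNReal}
    {s : Set X} (hF : LipschitzOnWith K F s) (hs : ∀ t ∈ Set.uIcc a b, f t ∈ s) :
    AbsolutelyContinuousOnInterval (fun t => F (f t)) a b := by
  rw [absolutelyContinuousOnInterval_iff] at hf ⊢
  intro ε hε
  -- K + 1 instead of K covers K = 0 and keeps the final inequality strict.
  obtain ⟨δ, hδ, h⟩ := hf (ε / (K + 1)) (by positivity)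
  refine ⟨δ, hδ, fun I hI hlen => ?_⟩
  calc _ ≤ ∑ i ∈ Finset.range I.1, K * dist (f (I.2 i).1) (f (I.2 i).2) :=
        Finset.sum_le_sum fun i hi =>
          hF.dist_le_mul _ (hs _ (hI.1 i hi).1) _ (hs _ (hI.1 i hi).2)
    _ = K * ∑ i ∈ Finset.range I.1, dist (f (I.2 i).1) (f (I.2 i).2) := by rw [Finset.mul_sum]
    _ ≤ K * (ε / (K + 1)) := by gcongr; exact (h I hI hlen).le
    _ < (K + 1) * (ε / (K + 1)) := by gcongr; linarith
    _ = ε := by field_simp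

theorem comp_neg {X : Type*} [PseudoMetricSpace X] {f : ℝ → X} {a b : ℝ}
    (hf : AbsolutelyContinuousOnInterval f a b) :
    AbsolutelyContinuousOnInterval (fun t => f (-t)) (-a) (-b) := by
  rw [absolutelyContinuousOnInterval_iff] at hf ⊢
  intro ε hε
  obtain ⟨δ, hδ, h⟩ := hf ε hε
  have hmem : ∀ t : ℝ, t ∈ Set.uIcc (-a) (-b) → -t ∈ Set.uIcc a b := fun t ht => by
    rw [Set.mem_uIcc] at ht ⊢
    rcases ht with ⟨h1, h2⟩ | ⟨h1, h2⟩
    · right; constructor <;> linarith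
    · left; constructor <;> linarith
  refine ⟨δ, hδ, fun I hI hlen =>
    h (I.1, fun i => (-(I.2 i).1, -(I.2 i).2)) ⟨fun i hi => ?_, fun i hi j hj hij => ?_⟩ ?_⟩
  · exact ⟨hmem _ (hI.1 i hi).1, hmem _ (hI.1 i hi).2⟩
  · have := hI.2 hi hj hij
    simp only [Function.onFun, Set.uIoc, Set.Ioc_disjoint_Ioc] at this ⊢
    simp only [max_neg_neg, min_neg_neg]
    exact neg_le_neg this
  · simpa [dist_neg_neg] using hlen

theorem comp_contDiff {V W : Type*} [NormedAddCommGroup V] [NormedSpace ℝ V]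
    [FiniteDimensional ℝ V] [NormedAddCommGroup W] [NormedSpace ℝ W] {f : ℝ → V} {a b : ℝ}
    (hf : AbsolutelyContinuousOnInterval f a b) {F : V → W} (hF : ContDiff ℝ 1 F) :
    AbsolutelyContinuousOnInterval (fun t => F (f t)) a b := by
  have := FiniteDimensional.proper ℝ V
  obtain ⟨C, hC⟩ := hf.exists_bound
  obtain ⟨K, hK⟩ := hF.contDiffOn.exists_lipschitzOnWith (by decide)
    (convex_closedBall 0 C) (isCompact_closedBall (0 : V) C)
  exact hf.comp_lipschitzOnWith hK fun t ht => mem_closedBall_zero_iff.2 (hC t ht)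

end AbsolutelyContinuousOnInterval

namespace CarnotGroup

variable {𝔤 : Type*} [NormedAddCommGroup 𝔤] [NormedSpace ℝ 𝔤]
  (G : CarnotGroup 𝔤) {r : ℕ} (X : Module.Basis (Fin r) ℝ (G.layer 1))

/-! ### Lengths of horizontal curves -/

/-- The lengths of the horizontal curves that join `x` to `y`. -/
def lengths (x y : 𝔤) : Set ℝ :=
  {l : ℝ | ∃ (a b : ℝ) (γ : ℝ → 𝔤) (u : Fin r → ℝ → ℝ), a ≤ b ∧ G.IsHorizontal X a b γ u ∧
    γ a = x ∧ γ b = y ∧ l = controlLength a b u}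

theorem ccDist_eq_sInf (x y : 𝔤) : G.ccDist X x y = sInf (G.lengths X x y) := rfl

theorem nonneg_of_mem_lengths {x y : 𝔤} {l : ℝ} (hl : l ∈ G.lengths X x y) : 0 ≤ l := by
  obtain ⟨a, b, γ, u, hab, -, -, -, rfl⟩ := hl
  exact intervalIntegral.integral_nonneg hab fun t _ => Real.sqrt_nonneg _

theorem ccDist_nonneg (x y : 𝔤) : 0 ≤ G.ccDist X x y :=
  Real.sInf_nonneg fun _ hl => G.nonneg_of_mem_lengths X hl

theorem ccDist_le_of_mem_lengths {x y : 𝔤} {l : ℝ} (hl : l ∈ G.lengths X x y) :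
    G.ccDist X x y ≤ l :=
  csInf_le ⟨0, fun _ h => G.nonneg_of_mem_lengths X h⟩ hl

theorem lengths_subset_swap (x y : 𝔤) : G.lengths X x y ⊆ G.lengths X y x := by
  rintro l ⟨a, b, γ, u, hab, ⟨h1, h2, h3⟩, rfl, rfl, rfl⟩
  refine ⟨-b, -a, fun t => γ (-t), fun j t => -u j (-t), neg_le_neg hab, ⟨h1.comp_neg.symm,
    fun j => ?_, ?_⟩, by simp, by simp, ?_⟩
  · exact ((IntervalIntegrable.iff_comp_neg).1 (h2 j)).symm.neg
  · rw [ae_restrict_iff' measurableSet_Icc] at h3 ⊢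
    filter_upwards [(Measure.measurePreserving_neg (volume : Measure ℝ)).quasiMeasurePreserving.ae h3]
      with t ht hmem
    have h4 := (ht ⟨by linarith [hmem.2], by linarith [hmem.1]⟩).scomp t (hasDerivAt_neg t)
    refine h4.congr_deriv ?_
    simp
  · have := intervalIntegral.integral_comp_neg (a := -b) (b := -a)
      (fun t => Real.sqrt (∑ j, (u j t) ^ 2))
    simp only [neg_neg] at this
    simp [controlLength, this]

theorem ccDist_comm (x y : 𝔤) : G.ccDist X x y = G.ccDist X y x := by
  rw [ccDist_eq_sInf, ccDist_eq_sInf,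
    (G.lengths_subset_swap X x y).antisymm (G.lengths_subset_swap X y x)]

theorem omega_neg (E : G.layer 1) : G.omega X (-E) = G.omega X E := by
  simp [omega]

theorem omega_zero : G.omega X 0 = 0 := by
  simp [omega]

/-- The inner product of `E` with the projection onto the horizontal layer. -/
def pairing (E : G.layer 1) : 𝔤 →ₗ[ℝ] ℝ :=
  ∑ j, X.repr E j • (X.coord j ∘ₗ (G.component 1).codRestrict (G.layer 1) (G.component_mem 1))

theorem pairing_apply (E : G.layer 1) (z : 𝔤) :
    G.pairing X E z = ∑ j, X.repr E j * X.repr ⟨G.component 1 z, G.component_mem 1 z⟩ j := by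
  simp [pairing, LinearMap.sum_apply]
  rfl

theorem pairing_congr (E : G.layer 1) {z w : 𝔤} (h : G.component 1 z = G.component 1 w) :
    G.pairing X E z = G.pairing X E w := by
  simp only [pairing_apply, h]

theorem pairing_of_mem (E F : G.layer 1) :
    G.pairing X E (F : 𝔤) = ∑ j, X.repr E j * X.repr F j := by
  simp only [pairing_apply, G.component_of_mem F.2, Subtype.coe_eta]

theorem pairing_self (E : G.layer 1) (hE : G.omega X E = 1) : G.pairing X E (E : 𝔤) = 1 := by
  rw [pairing_of_mem]
  rw [omega, Real.sqrt_eq_one] at hE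
  simpa only [pow_two] using hE

theorem pairing_neg (E : G.layer 1) (z : 𝔤) : G.pairing X (-E) z = -G.pairing X E z := by
  simp [pairing_apply]

theorem isLipschitzWith_lip {f : 𝔤 → ℝ} (hf : G.IsLipschitz X f) :
    G.IsLipschitzWith X (G.lip X f) f := by
  refine ⟨Real.sInf_nonneg fun K hK => hK.1, fun x y => ?_⟩
  -- At distance 0 any Lipschitz constant already forces f x = f y; otherwise divide by the distance
  -- and take the infimum.
  rcases (G.ccDist_nonneg X x y).eq_or_lt with h0 | h0
  · obtain ⟨K, hK⟩ := hf
    have := hK.2 x y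
    rwa [← h0, mul_zero] at this ⊢
  · rw [← div_le_iff₀ h0]
    exact le_csInf hf fun K hK => (div_le_iff₀ h0).2 (hK.2 x y)

theorem dilation_zero (c : ℝ) : G.dilation c 0 = 0 := by
  rw [dilation_eq_scale, map_zero]

theorem pairing_dilation (E : G.layer 1) (c : ℝ) (x : 𝔤) :
    G.pairing X E (G.dilation c x) = c * G.pairing X E x := by
  rw [← smul_eq_mul, ← map_smul]
  exact G.pairing_congr X E (by rw [component_one_dilation, map_smul])

theorem HasDirDeriv.exists_abs_sub_le {G : CarnotGroup 𝔤} {f : 𝔤 → ℝ} {E x : 𝔤} {c : ℝ} (h : G.HasDirDeriv f E x c)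
    {η : ℝ} (hη : 0 < η) : ∃ δ : ℝ, 0 < δ ∧ ∀ s : ℝ, s ≠ 0 → |s| < δ →
      |f (G.mul x (s • E)) - f x - s * c| ≤ η * |s| := by
  obtain ⟨δ, hδ, h2⟩ := Metric.tendsto_nhdsWithin_nhds.1 h η hη
  refine ⟨δ, hδ, fun s hs hsδ => ?_⟩
  have h3 := h2 hs (by simpa using hsδ)
  rw [Real.dist_eq] at h3
  have h4 : f (G.mul x (s • E)) - f x - s * c =
      ((f (G.mul x (G.exp (s • E))) - f x) / s - c) * s := by
    rw [sub_mul, div_mul_cancel₀ _ hs, mul_comm c, exp]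
  rw [h4, abs_mul]
  exact mul_le_mul_of_nonneg_right h3.le (abs_nonneg _)

/-! ### Invariance and homogeneity of the distance, and its calibration by ⟨E, ·⟩ -/

variable [FiniteDimensional ℝ 𝔤]

theorem lengths_subset_mul_left (g x y : 𝔤) :
    G.lengths X x y ⊆ G.lengths X (G.mul g x) (G.mul g y) := by
  rintro l ⟨a, b, γ, u, hab, ⟨h1, h2, h3⟩, rfl, rfl, rfl⟩
  refine ⟨a, b, fun t => G.mul g (γ t), u, hab, ⟨h1.comp_contDiff (G.contDiff_mul_left g), h2, ?_⟩,
    rfl, rfl, rfl⟩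
  filter_upwards [h3] with t ht
  refine ((G.differentiable_mul_left g (γ t)).hasFDerivAt.comp_hasDerivAt t ht).congr_deriv ?_
  simp [map_sum, fderiv_mul_leftInvariantField]

theorem ccDist_mul_left (g x y : 𝔤) :
    G.ccDist X (G.mul g x) (G.mul g y) = G.ccDist X x y := by
  rw [ccDist_eq_sInf, ccDist_eq_sInf]
  congr 1
  refine Set.Subset.antisymm ?_ (G.lengths_subset_mul_left X g x y)
  have := G.lengths_subset_mul_left X (-g) (G.mul g x) (G.mul g y)
  rwa [neg_mul_cancel_left, neg_mul_cancel_left] at this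

theorem mul_mem_lengths_dilation {c : ℝ} (hc : 0 ≤ c) {x y : 𝔤} {l : ℝ}
    (hl : l ∈ G.lengths X x y) : c * l ∈ G.lengths X (G.dilation c x) (G.dilation c y) := by
  obtain ⟨a, b, γ, u, hab, ⟨h1, h2, h3⟩, rfl, rfl, rfl⟩ := hl
  set δ : 𝔤 →L[ℝ] 𝔤 := LinearMap.toContinuousLinearMap (G.scale fun i => c ^ i) with hδ
  have hd : ∀ x, G.dilation c x = δ x := fun x => G.dilation_eq_scale c x
  refine ⟨a, b, fun t => G.dilation c (γ t), fun j t => c * u j t, hab,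
    ⟨?_, fun j => (h2 j).const_mul c, ?_⟩, rfl, rfl, ?_⟩
  · simp only [hd]
    exact h1.comp_contDiff δ.contDiff
  · filter_upwards [h3] with t ht
    have h4 := δ.hasFDerivAt.comp_hasDerivAt t ht
    simp only [Function.comp_def, ← hd] at h4
    refine h4.congr_deriv ?_
    rw [hd, map_sum]
    refine Finset.sum_congr rfl fun j _ => ?_
    rw [map_smul, ← hd, G.dilation_leftInvariantField c (X j).2, smul_smul, mul_comm]
  · rw [controlLength, controlLength, ← intervalIntegral.integral_const_mul]
    congr 1
    ext t
    simp only [mul_pow, ← Finset.mul_sum]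
    rw [Real.sqrt_mul (sq_nonneg c), Real.sqrt_sq hc]

open scoped Pointwise in
theorem ccDist_dilation {c : ℝ} (hc : 0 < c) (x y : 𝔤) :
    G.ccDist X (G.dilation c x) (G.dilation c y) = c * G.ccDist X x y := by
  have hset : G.lengths X (G.dilation c x) (G.dilation c y) = c • G.lengths X x y := by
    refine Set.Subset.antisymm (fun l hl => ?_) ?_
    · have := G.mul_mem_lengths_dilation X (inv_nonneg.2 hc.le) hl
      have h2 := fun z => G.dilation_dilation_inv (inv_ne_zero hc.ne') z
      simp only [inv_inv] at h2
      rw [h2, h2] at this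
      exact Set.mem_smul_set.2 ⟨_, this, by rw [smul_eq_mul, mul_inv_cancel_left₀ hc.ne']⟩
    · rintro _ ⟨l, hl, rfl⟩
      exact G.mul_mem_lengths_dilation X hc.le hl
  rw [ccDist_eq_sInf, ccDist_eq_sInf, hset, Real.sInf_smul_of_nonneg hc.le, smul_eq_mul]

theorem ccDist_zero_dilation {c : ℝ} (hc : 0 < c) (w : 𝔤) :
    G.ccDist X 0 (G.dilation c w) = c * G.ccDist X 0 w := by
  have := G.ccDist_dilation X hc 0 w
  rwa [dilation_zero] at this

theorem ccNorm_dilation {c : ℝ} (hc : 0 < c) (w : 𝔤) :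
    G.ccNorm X (G.dilation c w) = c * G.ccNorm X w := by
  have := G.ccDist_dilation X hc w 0
  rwa [dilation_zero] at this

theorem ccDist_zero_neg (w : 𝔤) : G.ccDist X 0 (-w) = G.ccDist X 0 w := by
  rw [← G.ccDist_mul_left X w, mul_zero', mul_neg_self, ccDist_comm]

theorem pairing_mul (E : G.layer 1) (x y : 𝔤) :
    G.pairing X E (G.mul x y) = G.pairing X E x + G.pairing X E y := by
  rw [← map_add]
  exact G.pairing_congr X E (by rw [component_one_mul, map_add])

/-- Along a horizontal curve ⟨E, γ⟩ has derivative ∑ E_j u_j, at most |u| by Cauchy-Schwarz;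
integrate. -/
theorem abs_pairing_sub_le_of_mem_lengths (E : G.layer 1) (hE : G.omega X E = 1) {x y : 𝔤} {l : ℝ}
    (hl : l ∈ G.lengths X x y) : |G.pairing X E y - G.pairing X E x| ≤ l := by
  obtain ⟨a, b, γ, u, hab, ⟨h1, h2, h3⟩, rfl, rfl, rfl⟩ := hl
  set q : 𝔤 →L[ℝ] ℝ := LinearMap.toContinuousLinearMap (G.pairing X E) with hq
  have hac : AbsolutelyContinuousOnInterval (fun t => q (γ t)) a b := h1.comp_contDiff q.contDiff
  have hderiv : ∀ᵐ t ∂volume, t ∈ Set.Icc a b →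
      deriv (fun t => q (γ t)) t = ∑ j, X.repr E j * u j t := by
    rw [← ae_restrict_iff' measurableSet_Icc]
    filter_upwards [h3] with t ht
    refine (q.hasFDerivAt.comp_hasDerivAt t ht).deriv.trans ?_
    rw [map_sum]
    refine Finset.sum_congr rfl fun j _ => ?_
    rw [map_smul, smul_eq_mul, mul_comm]
    congr 1
    have : q (G.leftInvariantField (X j : 𝔤) (γ t)) = G.pairing X E (X j : 𝔤) :=
      G.pairing_congr X E (by
        rw [G.component_one_leftInvariantField (X j).2, G.component_of_mem (X j).2])
    rw [this, pairing_of_mem]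
    simp [Finsupp.single_apply]
  have hint : IntervalIntegrable (fun t => Real.sqrt (∑ j, (u j t) ^ 2)) volume a b := by
    have hs : IntervalIntegrable (fun t => ∑ j, |u j t|) volume a b :=
by
      simpa only [Finset.sum_fn] using IntervalIntegrable.sum Finset.univ fun j _ => (h2 j).abs
    refine hs.mono_fun ?_ (Eventually.of_forall fun t => ?_)
    · have hm : ∀ j, AEMeasurable (u j) (volume.restrict (Set.uIoc a b)) := fun j =>
        (h2 j).def'.aestronglyMeasurable.aemeasurable
      have : AEMeasurable (fun t => ∑ j, (u j t) ^ 2) (volume.restrict (Set.uIoc a b)) :=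
        Finset.aemeasurable_fun_sum _ fun j _ => (hm j).pow_const 2
      exact this.sqrt.aestronglyMeasurable
    · simp only
      rw [Real.norm_of_nonneg (Real.sqrt_nonneg _),
        Real.norm_of_nonneg (Finset.sum_nonneg fun j _ => abs_nonneg _)]
      refine Real.sqrt_le_iff.2 ⟨Finset.sum_nonneg fun j _ => abs_nonneg _, ?_⟩
      simpa only [sq_abs] using Finset.sum_sq_le_sq_sum_of_nonneg (s := Finset.univ)
        (f := fun j => |u j t|) fun j _ => abs_nonneg _
  have hftc := hac.integral_deriv_eq_sub
  rw [show G.pairing X E (γ b) - G.pairing X E (γ a) = q (γ b) - q (γ a) from rfl, ← hftc,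
    ← Real.norm_eq_abs]
  refine intervalIntegral.norm_integral_le_of_norm_le hab ?_ hint
  filter_upwards [hderiv] with t ht hmem
  rw [ht (Set.Ioc_subset_Icc_self hmem), Real.norm_eq_abs]
  have hcs := Finset.sum_mul_sq_le_sq_mul_sq Finset.univ (fun j => X.repr E j) fun j => u j t
  rw [omega, Real.sqrt_eq_one] at hE
  rw [hE, one_mul] at hcs
  exact Real.abs_le_sqrt hcs

/-- Nonemptiness matters: without a joining curve the infimum takes the default value 0. -/
theorem pairing_le_ccNorm (E : G.layer 1) (hE : G.omega X E = 1) {z : 𝔤}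
    (hz : (G.lengths X z 0).Nonempty) : G.pairing X E z ≤ G.ccNorm X z := by
  refine le_csInf hz fun l hl => ?_
  have := G.abs_pairing_sub_le_of_mem_lengths X E hE hl
  rw [map_zero, zero_sub, abs_neg] at this
  exact (le_abs_self _).trans this

theorem leftInvariantField_sum (c : Fin r → ℝ) (p : 𝔤) :
    ∑ j, c j • G.leftInvariantField (X j : 𝔤) p =
      G.leftInvariantField ((∑ j, c j • X j : G.layer 1) : 𝔤) p := by
  simp [leftInvariantField_eq, map_sum]

theorem omega_mem_lengths (E : G.layer 1) : G.omega X E ∈ G.lengths X (E : 𝔤) 0 := by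
  refine ⟨0, 1, fun t => (1 - t) • (E : 𝔤), fun j _ => -X.repr E j, zero_le_one,
    ⟨?_, fun j => intervalIntegrable_const, ?_⟩, by simp, by simp, ?_⟩
  · refine ContDiffOn.absolutelyContinuousOnInterval (ContDiff.contDiffOn ?_)
    fun_prop
  · refine Eventually.of_forall fun t => ?_
    have h : HasDerivAt (fun t : ℝ => (1 - t) • (E : 𝔤)) ((-1 : ℝ) • (E : 𝔤)) t :=
      ((hasDerivAt_id t).const_sub 1).smul_const _
    refine h.congr_deriv ?_
    simp only [neg_smul, Finset.sum_neg_distrib, one_smul]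
    rw [leftInvariantField_sum, X.sum_repr, leftInvariantField_smul_self]
  · simp [controlLength, omega]

theorem ccNorm_of_omega_eq_one (E : G.layer 1) (hE : G.omega X E = 1) :
    G.ccNorm X (E : 𝔤) = 1 := by
  have h := G.omega_mem_lengths X E
  refine le_antisymm ((G.ccDist_le_of_mem_lengths X h).trans_eq hE) ?_
  rw [← G.pairing_self X E hE]
  exact G.pairing_le_ccNorm X E hE ⟨_, h⟩

/-! ### Pansu differentials -/

variable {G X}

theorem IsGLinear.map_zero {L : 𝔤 → ℝ} (hL : G.IsGLinear L) : L 0 = 0 := by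
  have := hL.1 0 0
  rw [mul_zero'] at this
  linarith

theorem IsGLinear.map_neg {L : 𝔤 → ℝ} (hL : G.IsGLinear L) (x : 𝔤) : L (-x) = -L x := by
  have := hL.1 (-x) x
  rw [neg_mul_self, hL.map_zero] at this
  linarith

theorem HasPansuDifferential.exists_abs_sub_le {f : 𝔤 → ℝ} {p : 𝔤} {L : 𝔤 → ℝ}
    (h : G.HasPansuDifferential X f p L) {η : ℝ} (hη : 0 < η) :
    ∃ δ : ℝ, 0 < δ ∧ ∀ w, 0 < G.ccDist X 0 w → G.ccDist X 0 w < δ →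
      |f (G.mul p w) - f p - L w| ≤ η * G.ccDist X 0 w := by
  obtain ⟨δ, hδ, h2⟩ := h.2 η hη
  refine ⟨δ, hδ, fun w hw hwδ => ?_⟩
  have hd : G.ccDist X p (G.mul p w) = G.ccDist X 0 w := by
    have := G.ccDist_mul_left X p 0 w
    rwa [mul_zero'] at this
  have hw' : G.mul (G.inv p) (G.mul p w) = w := G.neg_mul_cancel_left p w
  rcases eq_or_ne (G.mul p w) p with hp | hp
  · rw [hp, inv, neg_mul_self] at hw'
    rw [hp, ← hw', h.1.map_zero, sub_self, sub_zero, abs_zero]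
    exact mul_nonneg hη.le (G.ccDist_nonneg X _ _)
  · have := h2 _ hp (by rwa [hd])
    rw [hw', hd, div_lt_iff₀ hw] at this
    exact this.le

/-- At exp(E) δ_τ w, for small τ > 0, the calibration gives 1 + τ⟨E, w⟩ ≤ d, while differentiability
gives d = 1 + τ L(w) + o(τ). -/
theorem pairing_le_of_hasPansuDifferential {E : G.layer 1} (hE : G.omega X E = 1) {L : 𝔤 → ℝ}
    (hL : G.HasPansuDifferential X (G.ccNorm X) (E : 𝔤) L) {w : 𝔤} (hw : 0 < G.ccDist X 0 w) :
    G.pairing X E w ≤ L w := by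
  set d := G.ccDist X 0 w with hd
  refine le_of_forall_pos_le_add fun η hη => ?_
  obtain ⟨δ, hδ, h⟩ := hL.exists_abs_sub_le (η := η / d) (by positivity)
  -- The dilation factor is τ = 1/M. The term d/δ brings the dilated w within δ; |L w| + η excludes
  -- the default distance 0, which is too far from 1 + τ L(w).
  set M := d / δ + |L w| + η + 1 with hM
  have hM0 : 0 < M := by positivity
  have ht : 0 < M⁻¹ := inv_pos.2 hM0
  have h1 : M⁻¹ * d < δ := by
    rw [inv_mul_lt_iff₀ hM0]
    have : d / δ < M := by rw [hM]; linarith [abs_nonneg (L w)]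
    rwa [div_lt_iff₀ hδ] at this
  have hdil := G.ccDist_zero_dilation X ht w
  have h2 := h (G.dilation M⁻¹ w) (by rw [hdil]; positivity) (by rwa [hdil])
  rw [hdil, hL.1.2 _ ht, G.ccNorm_of_omega_eq_one X E hE, ← hd, mul_left_comm, div_mul_cancel₀ _ hw.ne',
    abs_le] at h2
  rcases (G.lengths X (G.mul (E : 𝔤) (G.dilation M⁻¹ w)) 0).eq_empty_or_nonempty with he | hne
  · have h3 : G.ccNorm X (G.mul (E : 𝔤) (G.dilation M⁻¹ w)) = 0 := by
      rw [ccNorm, ccDist_eq_sInf, he, Real.sInf_empty]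
    rw [h3] at h2
    have h4 : M⁻¹ * (|L w| + η) < 1 := by
      rw [inv_mul_lt_iff₀ hM0, hM]
      have : 0 ≤ d / δ := by positivity
      linarith
    have h5 : M⁻¹ * -|L w| ≤ M⁻¹ * L w := mul_le_mul_of_nonneg_left (neg_abs_le _) ht.le
    rw [mul_add] at h4
    rw [mul_neg] at h5
    linarith [h2.1]
  · have h3 := G.pairing_le_ccNorm X E hE hne
    rw [pairing_mul, pairing_dilation, G.pairing_self X E hE] at h3
    have h4 : M⁻¹ * G.pairing X E w ≤ M⁻¹ * (L w + η) := by rw [mul_add]; linarith [h2.2]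
    exact le_of_mul_le_mul_left h4 ht

/-- The Pansu differential of the distance at a horizontal point is the inner product with the
horizontal projection. -/
theorem eq_pairing_of_hasPansuDifferential {E : G.layer 1} (hE : G.omega X E = 1) {L : 𝔤 → ℝ}
    (hL : G.HasPansuDifferential X (G.ccNorm X) (E : 𝔤) L) {w : 𝔤} (hw : 0 < G.ccDist X 0 w) :
    L w = G.pairing X E w := by
  refine le_antisymm ?_ (pairing_le_of_hasPansuDifferential hE hL hw)
  -- Both sides are odd, so the inequality at -w is the reverse one.
  have := pairing_le_of_hasPansuDifferential hE hL (w := -w) (by rwa [ccDist_zero_neg])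
  rw [hL.1.map_neg, _root_.map_neg] at this
  linarith

/-- Translating by sE and dilating by 1/s gives d(w, -sE) = s d(E · δ_{1/s} w); the differential at
E applies when d(w)/s is small. -/
theorem exists_ccDist_neg_smul_le {E : G.layer 1} (hE : G.omega X E = 1) {L : 𝔤 → ℝ}
    (hL : G.HasPansuDifferential X (G.ccNorm X) (E : 𝔤) L) {η : ℝ} (hη : 0 < η) :
    ∃ δ : ℝ, 0 < δ ∧ ∀ w s, 0 < s → 0 < G.ccDist X 0 w → G.ccDist X 0 w < δ * s →
      G.ccDist X w (-(s • (E : 𝔤))) ≤ s + L w + η * G.ccDist X 0 w := by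
  obtain ⟨δ, hδ, h⟩ := hL.exists_abs_sub_le hη
  refine ⟨δ, hδ, fun w s hs hw hws => ?_⟩
  have hs' : 0 < s⁻¹ := inv_pos.2 hs
  have hdil := G.ccDist_zero_dilation X hs' w
  have h1 := h (G.dilation s⁻¹ w) (by rw [hdil]; positivity)
    (by rw [hdil, inv_mul_lt_iff₀ hs, mul_comm]; exact hws)
  rw [hdil, hL.1.2 _ hs', G.ccNorm_of_omega_eq_one X E hE, abs_le] at h1
  have h2 : G.ccDist X w (-(s • (E : 𝔤))) =
      s * G.ccNorm X (G.mul (E : 𝔤) (G.dilation s⁻¹ w)) := by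
    rw [← G.ccNorm_dilation X hs, dilation_mul, G.dilation_dilation_inv hs.ne',
      G.dilation_of_mem_layer_one s E.2, ← G.ccDist_mul_left X (s • (E : 𝔤)), mul_neg_self]
    rfl
  rw [h2]
  have h3 := mul_le_mul_of_nonneg_left h1.2 hs.le
  have h4 : s * (s⁻¹ * L w) = L w := mul_inv_cancel_left₀ hs.ne' _
  have h5 : s * (η * (s⁻¹ * G.ccDist X 0 w)) = η * G.ccDist X 0 w := by
    rw [mul_left_comm, mul_inv_cancel_left₀ hs.ne']
  rw [h5, mul_sub, mul_sub, h4] at h3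
  linarith

/-- If the directional derivative along `E` is maximal, differentials of the distance at `E` and at
`-E` that are opposite to each other yield the Pansu differential of `f`. -/
theorem hasPansuDifferential_of_dirDeriv_eq_lip {f : 𝔤 → ℝ} {K : ℝ} (hf : G.IsLipschitzWith X K f)
    {x : 𝔤} {E : G.layer 1} (hE : G.omega X E = 1) (hmax : G.HasDirDeriv f (E : 𝔤) x K)
    {L L' : 𝔤 → ℝ} (hL : G.HasPansuDifferential X (G.ccNorm X) (E : 𝔤) L)
    (hL' : G.HasPansuDifferential X (G.ccNorm X) ((-E : G.layer 1) : 𝔤) L') :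
    G.HasPansuDifferential X f x (fun w => K * L w) := by
  have hK := hf.1
  have hE' : G.omega X (-E) = 1 := by rw [omega_neg, hE]
  refine ⟨⟨fun y z => by simp only [hL.1.1, mul_add],
    fun c hc y => by simp only [hL.1.2 c hc, mul_left_comm]⟩, fun ε hε => ?_⟩
  -- The distance estimate costs Kηt and the directional derivative ηt, in total εt/2.
  set η := ε / (2 * (K + 1)) with hη'
  have hη : 0 < η := by positivity
  obtain ⟨δ₁, hδ₁, h₁⟩ := exists_ccDist_neg_smul_le hE hL hη
  obtain ⟨δ₂, hδ₂, h₂⟩ := exists_ccDist_neg_smul_le hE' hL' hη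
  -- ρ is the fixed ratio t/s. The tolerance ηρ below turns the error ηρs of the directional
  -- derivative into ηt.
  set ρ := min δ₁ δ₂ / 2 with hρ'
  have hρ : 0 < ρ := by positivity
  have hρ₁ : ρ < δ₁ := by rw [hρ']; linarith [min_le_left δ₁ δ₂]
  have hρ₂ : ρ < δ₂ := by rw [hρ']; linarith [min_le_right δ₁ δ₂]
  obtain ⟨δ₃, hδ₃, h₃⟩ := hmax.exists_abs_sub_le (η := η * ρ) (by positivity)
  refine ⟨δ₃ * ρ, by positivity, fun y _ hyδ => ?_⟩
  rcases (G.ccDist_nonneg X x y).eq_or_lt with h0 | h0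
  -- At distance 0 the quotient is 0 by the convention for division by zero.
  · rwa [← h0, div_zero]
  obtain ⟨w, rfl⟩ : ∃ w, y = G.mul x w := ⟨_, (G.mul_neg_cancel_left x y).symm⟩
  have hd : G.ccDist X x (G.mul x w) = G.ccDist X 0 w := by
    have := G.ccDist_mul_left X x 0 w
    rwa [mul_zero'] at this
  rw [hd] at hyδ h0 ⊢
  rw [inv, neg_mul_cancel_left, div_lt_iff₀ h0]
  set t := G.ccDist X 0 w with ht
  have hs : 0 < t / ρ := by positivity
  set s := t / ρ with hs'
  have hts : t = ρ * s := by rw [hs']; field_simp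
  have hsδ : s < δ₃ := by rwa [hs', div_lt_iff₀ hρ]
  have hLL : L' w = -L w := by
    rw [eq_pairing_of_hasPansuDifferential hE hL h0, eq_pairing_of_hasPansuDifferential hE' hL' h0,
      pairing_neg]
  have u₁ := h₁ w s hs h0 (by rw [← ht, hts]; exact mul_lt_mul_of_pos_right hρ₁ hs)
  have u₂ := h₂ w s hs h0 (by rw [← ht, hts]; exact mul_lt_mul_of_pos_right hρ₂ hs)
  have e₁ := h₃ (-s) (neg_ne_zero.2 hs.ne') (by rwa [abs_neg, abs_of_pos hs])
  have e₂ := h₃ s hs.ne' (by rwa [abs_of_pos hs])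
  have hηs : η * ρ * s = η * t := by rw [hts, mul_assoc]
  rw [abs_neg, abs_of_pos hs, hηs, abs_le, neg_smul] at e₁
  rw [abs_of_pos hs, hηs, abs_le] at e₂
  -- Comparison with x exp(-sE) bounds f(xw) from above, comparison with x exp(sE) from below.
  have f₁ := (abs_le.1 (hf.2 (G.mul x w) (G.mul x (-(s • (E : 𝔤)))))).2
  have f₂ := (abs_le.1 (hf.2 (G.mul x w) (G.mul x (s • (E : 𝔤))))).1
  rw [ccDist_mul_left] at f₁ f₂
  rw [Submodule.coe_neg, smul_neg, neg_neg, hLL] at u₂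
  have v₁ := mul_le_mul_of_nonneg_left u₁ hK
  have v₂ := mul_le_mul_of_nonneg_left u₂ hK
  have hηε : (K + 1) * η * t < ε * t := by
    refine mul_lt_mul_of_pos_right ?_ h0
    have : (K + 1) * η = ε / 2 := by rw [hη']; field_simp
    linarith
  refine lt_of_le_of_lt (abs_le.2 ⟨?_, ?_⟩) hηε
  · nlinarith
  · nlinarith

end CarnotGroup

end

/-! ### Pansu differentiability where the directional derivative is maximal -/

theorem theorem3 {𝔤 : Type*} [NormedAddCommGroup 𝔤] [NormedSpace ℝ 𝔤] [FiniteDimensional ℝ 𝔤]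
    (G : CarnotGroup 𝔤) {r : ℕ} (X : Module.Basis (Fin r) ℝ (G.layer 1))
    (hd : G.DistDifferentiableInHorizontalDirections X)
    (f : 𝔤 → ℝ) (hf : G.IsLipschitz X f) (x : 𝔤)
    (E : G.layer 1) (hE : G.omega X E = 1)
    (hmax : G.HasDirDeriv f (E : 𝔤) x (G.lip X f)) :
    G.PansuDifferentiableAt X f x ∧
      ∀ L : 𝔤 → ℝ, G.HasPansuDifferential X (G.ccNorm X) (G.exp (E : 𝔤)) L →
        G.HasPansuDifferential X f x (fun w => G.lip X f * L w) := by
  have hE0 : E ≠ 0 := by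
    rintro rfl
    rw [G.omega_zero X] at hE
    exact zero_ne_one hE
  -- The differential at exp(-E) is needed for the lower bound on f.
  obtain ⟨L', hL'⟩ := hd (-E) (neg_ne_zero.2 hE0)
  have key : ∀ L : 𝔤 → ℝ, G.HasPansuDifferential X (G.ccNorm X) (G.exp (E : 𝔤)) L →
      G.HasPansuDifferential X f x (fun w => G.lip X f * L w) := fun L hL =>
    CarnotGroup.hasPansuDifferential_of_dirDeriv_eq_lip (G.isLipschitzWith_lip X hf) hE hmax hL hL'
  obtain ⟨L, hL⟩ := hd E hE0
  exact ⟨⟨_, key L hL⟩, key⟩
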